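/- Let $F_k=\langle x_1,\dots,x_k\rangle$ be the free group and let $\Omega\in F_k$ be an element that is not a power, i.e. $\Omega\neq v^m$ for all $v\in F_k$, $m\ge 2$. Let $\Omega=x_{\alpha_1}^{\beta_1}\cdots x_{\alpha_\ell}^{\beta_\ell}$ be its reduced form ($\beta_j\in\mathbb Z\setminus\{0\}$, $\alpha_{j+1}\ne\alpha_j$), assume $\alpha_\ell\neq\alpha_1$, and put $\gamma^i(\Omega)=(|\beta_j|)_{j:\,\alpha_j=i}$ for $1\le i\le k$. Let $d\ge 1$ and $w=\Omega^d$, with canonical form $w=x_{k_r}^{\varepsilon_r}\cdots x_{k_1}^{\varepsilon_1}$ ($\varepsilon_j=\pm1$, no cancellation). For permutations $\boldsymbol\sigma=(\sigma_1,\dots,\sigma_k)$ of $\{1,\dots,n\}$, let $i_0=1$ and $i_j=\sigma_{k_j}^{\varepsilon_j}\cdots\sigma_{k_1}^{\varepsilon_1}(1)$ for $1\le j\le r$ be the trajectory of $1$ under $w$. Let $\mathcal G_i(\boldsymbol\sigma)$ be the oriented graph (loops allowed, no multiple edges) on $\{1,\dots,n\}$ whose edges are the pairs $(i_{j-1},i_j)$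 with $k_j=i,\ \varepsilon_j=1$ and the pairs $(i_j,i_{j-1})$ with $k_j=i,\ \varepsilon_j=-1$. Two finite oriented graphs are equivalent if they become isomorphic after removal of their isolated vertices (vertices incident to no edge and no loop); $\widehat{\mathcal G}_i(\boldsymbol\sigma)$ denotes the equivalence class of $\mathcal G_i(\boldsymbol\sigma)$. For a finite tuple $\gamma=(\gamma_1,\dots,\gamma_q)$ of positive integers, $\mathcal T_\gamma$ is the class of the disjoint union of $q$ directed paths with $\gamma_1,\dots,\gamma_q$ edges (the class of edgeless graphs if $q=0$), and $h\cdot\gamma$ is $\gamma$ repeated $h$ times. Let $c_1(\tau)$ be the length of the cycle of $\tau$ containing $1$. For each $n\geq 1$ let $\rho_{1,n},\dots,\rho_{k,n}$ be independent and uniformly distributed on the symmetric group $\mathfrak S_n$. Then, for all equivalence classes $\hat g_1,\dots,\hat g_k$ of finite oriented graphs (the class of edgeless graphs is allowed), $$\lim_{n\to\infty} n\,\mathbb P\Big(\forall i\in\{1,\dots,k\},\ \widehat{\mathcal G}_i(\rho_{1,n},\dots,\rho_{k,n})=\hat g_i,\ \ c_1\big(w(\rho_{1,n},\dots,\rho_{k,n})\big)=1\Big)=\sum_{h\mid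 d}\ \prod_{i=1}^k \mathbf 1_{\{\hat g_i=\mathcal T_{h\cdot\gamma^i(\Omega)}\}},$$ where the sum runs over the positive divisors $h$ of $d$. -/

import Mathlib

open MeasureTheory ProbabilityTheory Filter Topology

namespace WordPerm

/-! ### Oriented graphs up to isomorphism and isolated vertices -/

/-- The non-isolated vertices of an oriented graph (a vertex carrying a loop is not isolated). -/
def NonIsolated {V : Type*} (g : Digraph V) (v : V) : Prop :=
  ∃ u, g.Adj v u ∨ g.Adj u v

/-- Two oriented graphs are equivalent if they become isomorphic (as oriented graphs)
after removal of their isolated vertices. -/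
def GraphEquiv {V W : Type*} (g : Digraph V) (g' : Digraph W) : Prop :=
  Nonempty (Subrel g.Adj (NonIsolated g) ≃r Subrel g'.Adj (NonIsolated g'))

/-- Equivalence of finite oriented graphs. Loops are allowed, multiple edges are not. -/
instance graphSetoid : Setoid (Σ n : ℕ, Digraph (Fin n)) where
  r g g' := GraphEquiv g.2 g'.2
  iseqv :=
    { refl := fun _ => ⟨RelIso.refl _⟩
      symm := fun ⟨e⟩ => ⟨e.symm⟩
      trans := fun ⟨e⟩ ⟨f⟩ => ⟨e.trans f⟩ }

/-- Equivalence classes of finite oriented graphs. The class of the edgeless graphs is one of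
them (and the graph without vertices lies in it). -/
def GraphClass : Type := Quotient graphSetoid

noncomputable instance : DecidableEq GraphClass := Classical.decEq _

/-- The class of an oriented graph with vertex set `Fin n`. -/
def graphClass {n : ℕ} (g : Digraph (Fin n)) : GraphClass :=
  Quotient.mk graphSetoid ⟨n, g⟩

/-- The disjoint union of straight paths with `γ₁, γ₂, …` edges: the `j`-th path has the
`γⱼ + 1` vertices `(j, 0), …, (j, γⱼ)` and the edges `(j, a) → (j, a + 1)`. -/
def pathForest (γ : List ℕ) : Digraph (Σ j : Fin γ.length, Fin (γ.get j + 1)) where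
  Adj p q := ∃ (j : Fin γ.length) (a : Fin (γ.get j)), p = ⟨j, a.castSucc⟩ ∧ q = ⟨j, a.succ⟩

/-- The class `T_γ` of disjoint unions of straight paths with `γ₁, γ₂, …` edges
(for the empty tuple, the class of the edgeless graphs). The vertices of the representative
are numbered by `finSigmaFinEquiv`. -/
def straightClass (γ : List ℕ) : GraphClass :=
  graphClass (n := ∑ j : Fin γ.length, (γ.get j + 1))
    { Adj := fun u v =>
        (pathForest γ).Adj (finSigmaFinEquiv.symm u) (finSigmaFinEquiv.symm v) }

/-- `h · γ`: the tuple `γ` repeated `h` times. -/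
def repeatTuple (h : ℕ) (γ : List ℕ) : List ℕ :=
  (List.replicate h γ).flatten

/-! ### Words -/

/-- `Ω` is a power if `Ω = v ^ m` for some `m ≥ 2`. -/
def IsPower {G : Type*} [Group G] (Ω : G) : Prop :=
  ∃ (v : G) (m : ℕ), 2 ≤ m ∧ Ω = v ^ m

/-- `[(α₁, β₁), …, (αₗ, βₗ)]` is the reduced form of `w`: `w = x_{α₁}^{β₁} ⋯ x_{αₗ}^{βₗ}` with
non-zero exponents and with neighbouring letters different. -/
def IsReducedForm {k : ℕ} (L : List (Fin k × ℤ)) (w : FreeGroup (Fin k)) : Prop :=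
  (∀ p ∈ L, p.2 ≠ 0) ∧ L.IsChain (fun p q => p.1 ≠ q.1) ∧
    w = (L.map fun p => FreeGroup.of p.1 ^ p.2).prod

/-- The tuple `γ^i = (|βⱼ|)_{αⱼ = i}` read off from a reduced form. -/
def gammaTuple {k : ℕ} (i : Fin k) (L : List (Fin k × ℤ)) : List ℕ :=
  (L.filter fun p => p.1 = i).map fun p => p.2.natAbs

/-- The word map: `w(σ₁, …, σₖ)`. -/
def wordMap {k n : ℕ} (w : FreeGroup (Fin k)) (σ : Fin k → Equiv.Perm (Fin n)) :
    Equiv.Perm (Fin n) :=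
  FreeGroup.lift σ w

/-! ### Trajectories -/

/-- The letters of the canonical form `w = x_{k_r}^{ε_r} ⋯ x_{k_1}^{ε_1}`, in the order
in which they act: `(k_1, ε_1), …, (k_r, ε_r)`; `true` stands for `ε = 1`, `false` for
`ε = -1`. -/
def letters {k : ℕ} (w : FreeGroup (Fin k)) : List (Fin k × Bool) :=
  w.toWord.reverse

/-- The permutation `σ_i ^ ε`. -/
def letterPerm {k n : ℕ} (σ : Fin k → Equiv.Perm (Fin n)) (a : Fin k × Bool) :
    Equiv.Perm (Fin n) :=
  if a.2 then σ a.1 else (σ a.1)⁻¹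

/-- The `j`-th point `σ_{k_j}^{ε_j} ⋯ σ_{k_1}^{ε_1}(m)` of the trajectory of `m` under `w`. -/
def trajectory {k n : ℕ} (w : FreeGroup (Fin k)) (σ : Fin k → Equiv.Perm (Fin n)) (m : Fin n)
    (j : ℕ) : Fin n :=
  ((letters w).take j).foldl (fun x a => letterPerm σ a x) m

/-- The graph formed by the edges of the trajectory of `m` under `w` that belong to the
`i`-th permutation. The step that applies `σ_i` contributes the edge from the old point to the
new one, the step that applies `σ_i⁻¹` the edge from the new point to the old one. -/
def trajGraph {k n : ℕ} (w : FreeGroup (Fin k)) (σ : Fin k → Equiv.Perm (Fin n)) (m : Fin n)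
    (i : Fin k) : Digraph (Fin n) where
  Adj u v := ∃ j : ℕ,
    ((letters w)[j]? = some (i, true) ∧ u = trajectory w σ m j ∧ v = trajectory w σ m (j + 1)) ∨
    ((letters w)[j]? = some (i, false) ∧ u = trajectory w σ m (j + 1) ∧ v = trajectory w σ m j)

/-- The length of the cycle of `σ` containing `m`. -/
noncomputable def cycleLength {n : ℕ} (σ : Equiv.Perm (Fin n)) (m : Fin n) : ℕ :=
  Function.minimalPeriod σ m

/-! ### Random permutations -/

/-- The discrete σ-algebra on the symmetric group. -/
instance permMeasurableSpace (n : ℕ) : MeasurableSpace (Equiv.Perm (Fin n)) := ⊤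

end WordPerm

open WordPerm

namespace WordPerm

/-! ### Closed walks labelled by a cyclic word -/

/-! The event says that the trajectory of the base point closes up, so that it is a closed walk `x :
ZMod r → Fin N` with `x 0 = 0` reading the letters of `Ω ^ d` cyclically. Sort these walks by their
coincidence pattern, a setoid `K` on `ZMod r`, which also determines the graph classes. If `K` is
coherent with `V` classes and `E` edges over all colours, there are about `N ^ (V - 1)` rooted walks
of this pattern, and each is followed with probability about `N ^ (-E)`. After multiplication by
`N`, the pattern contributes a quantity of order `N ^ (V - E)` (`succ_mul_real_exists_walk`).

Since the word is cyclically reduced, at least two letters can be read at every vertex, whence `V ≤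
E` (`card_le_sum_numEdges`). In the limit a pattern with `V = E` counts `1` and all others count
`0`. If `V = E`, exactly two letters can be read at each vertex, so the walk neither branches nor
turns back: it winds around a cycle, and `K` is congruence modulo a period of the cyclic word
(`IsTight.exists_period`).

As `Ω` is not a power, such periods are multiples of its length (`length_dvd_of_period`), so the
tight patterns correspond to the divisors `h` of `d` (`isTight_iff_exists_winding`). The graph of
the walk is then a cycle labelled by `Ω ^ h`. Because the first and last generators of `Ω` differ,
the edges of one colour in this cycle are disjoint paths, one for each syllable
(`pathForest_equiv_walkGraph`). -/

/-- The inverse letter. -/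
def invLetter {C : Type*} (c : C × Bool) : C × Bool := (c.1, !c.2)

section Walks

variable {C : Type*} {r : ℕ} {V W : Type*}

/-- The origin of the oriented edge crossed at the `j`-th step of a closed walk. -/
def stepSource (a : ZMod r → C × Bool) (x : ZMod r → V) (j : ZMod r) : V :=
  if (a j).2 then x j else x (j + 1)

/-- The end of the oriented edge crossed at the `j`-th step of a closed walk. -/
def stepTarget (a : ZMod r → C × Bool) (x : ZMod r → V) (j : ZMod r) : V :=
  if (a j).2 then x (j + 1) else x j

/-- The edges of colour `i` of a closed walk. -/
def walkGraph (a : ZMod r → C × Bool) (x : ZMod r → V) (i : C) : Digraph V where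
  Adj u v := ∃ j, (a j).1 = i ∧ u = stepSource a x j ∧ v = stepTarget a x j

/-- In every colour, the edges of the walk form a partial injection. -/
def IsCoherent (a : ZMod r → C × Bool) (x : ZMod r → V) : Prop :=
  ∀ j j', (a j).1 = (a j').1 →
    (stepSource a x j = stepSource a x j' ↔ stepTarget a x j = stepTarget a x j')

/-- The origins of the edges of colour `i`. -/
def sources (a : ZMod r → C × Bool) (x : ZMod r → V) (i : C) : Set V :=
  stepSource a x '' {j | (a j).1 = i}

/-- The ends of the edges of colour `i`. -/
def targets (a : ZMod r → C × Bool) (x : ZMod r → V) (i : C) : Set V :=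
  stepTarget a x '' {j | (a j).1 = i}

/-- The number of edges of colour `i` of a coherent walk. -/
noncomputable def numEdges (a : ZMod r → C × Bool) (x : ZMod r → V) (i : C) : ℕ :=
  (sources a x i).ncard

/-- The letters which can be read from a vertex, along edges of the walk. -/
def lettersAt (a : ZMod r → C × Bool) (x : ZMod r → V) (v : V) : Set (C × Bool) :=
  {c | ∃ j, (x j = v ∧ a j = c) ∨ (x (j + 1) = v ∧ invLetter (a j) = c)}

/-- No letter is followed, cyclically, by its inverse. -/
def IsCyclicReduced (a : ZMod r → C × Bool) : Prop :=
  ∀ j, a (j + 1) ≠ invLetter (a j)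

variable {a : ZMod r → C × Bool} {x : ZMod r → V} {y : ZMod r → W}

lemma invLetter_ne (c : C × Bool) : invLetter c ≠ c := by
  obtain ⟨c, b⟩ := c
  cases b <;> simp [invLetter]

@[simp] lemma invLetter_invLetter (c : C × Bool) : invLetter (invLetter c) = c := by
  simp [invLetter]

/-- Coherence speaks of oriented edges; this lemma and the next one translate it into the direction
of travel, whatever the sign of the letter. -/
lemma IsCoherent.next_iff (h : IsCoherent a x) {j j' : ZMod r} (haj : a j = a j') :
    x j = x j' ↔ x (j + 1) = x (j' + 1) := by
  have := h j j' (by rw [haj])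
  unfold stepSource stepTarget at this
  rw [haj] at this
  split_ifs at this <;> tauto

lemma IsCoherent.next_iff_of_inv (h : IsCoherent a x) {j j' : ZMod r}
    (haj : a j = invLetter (a j')) : x j = x (j' + 1) ↔ x (j + 1) = x j' := by
  have := h j j' (by rw [haj]; rfl)
  unfold stepSource stepTarget at this
  rw [haj] at this
  cases hb : (a j').2 <;> simp [invLetter, hb] at this <;> tauto

/-- The size of an image depends only on the coincidences of the map. This serves to compare sources
with targets, and a walk with its relabellings. -/
lemma ncard_image_congr {ι α β : Type*} {f : ι → α} {g : ι → β} (s : Set ι)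
    (h : ∀ p ∈ s, ∀ q ∈ s, f p = f q ↔ g p = g q) : (f '' s).ncard = (g '' s).ncard := by
  refine Set.ncard_congr (fun v hv => g hv.choose) ?_ ?_ ?_
  · intro v hv
    exact ⟨_, hv.choose_spec.1, rfl⟩
  · intro v w hv hw e
    rw [← hv.choose_spec.2, ← hw.choose_spec.2]
    exact (h _ hv.choose_spec.1 _ hw.choose_spec.1).2 e
  · rintro _ ⟨j, hj, rfl⟩
    have hv : f j ∈ f '' s := ⟨j, hj, rfl⟩
    exact ⟨_, hv, (h _ hv.choose_spec.1 _ hj).1 hv.choose_spec.2⟩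

lemma targets_ncard (h : IsCoherent a x) (i : C) :
    (targets a x i).ncard = numEdges a x i :=
  ncard_image_congr _ fun p hp q hq => (h p q (hp.trans hq.symm)).symm

lemma setOf_true_mem_lettersAt (i : C) :
    {v | (i, true) ∈ lettersAt a x v} = sources a x i := by
  ext v
  simp only [lettersAt, Set.mem_ofPred_eq, sources, Set.mem_image, stepSource, invLetter]
  refine exists_congr fun j => ?_
  rcases hj : a j with ⟨c, b⟩
  cases b <;> simp [and_comm]

lemma setOf_false_mem_lettersAt (i : C) :
    {v | (i, false) ∈ lettersAt a x v} = targets a x i := by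
  ext v
  simp only [lettersAt, Set.mem_ofPred_eq, targets, Set.mem_image, stepTarget, invLetter]
  refine exists_congr fun j => ?_
  rcases hj : a j with ⟨c, b⟩
  cases b <;> simp [and_comm]

/-- Counting the letters at the vertices counts every edge twice. -/
lemma sum_ncard_lettersAt [Fintype C] [Fintype V] (h : IsCoherent a x) :
    ∑ v, (lettersAt a x v).ncard = 2 * ∑ i, numEdges a x i := by
  classical
  have h1 : ∀ v, (lettersAt a x v).ncard
      = (Finset.bipartiteAbove (fun v c => c ∈ lettersAt a x v) Finset.univ v).card := by
    intro v
    rw [← Set.ncard_coe_finset]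
    congr 1
    ext c
    simp [Finset.bipartiteAbove]
  have h2 : ∀ c, (Finset.bipartiteBelow (fun v c => c ∈ lettersAt a x v) Finset.univ c).card
      = {v | c ∈ lettersAt a x v}.ncard := by
    intro v
    rw [← Set.ncard_coe_finset]
    congr 1
    ext c
    simp [Finset.bipartiteBelow]
  simp_rw [h1]
  rw [Finset.sum_card_bipartiteAbove_eq_sum_card_bipartiteBelow]
  simp_rw [h2]
  rw [Fintype.sum_prod_type, Finset.mul_sum]
  refine Finset.sum_congr rfl fun i _ => ?_
  -- Each edge is counted once at its source, through the positive letter, and once at its target,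
  -- through the negative one.
  rw [Fintype.sum_bool, setOf_true_mem_lettersAt, setOf_false_mem_lettersAt, targets_ncard h,
    numEdges]
  ring

lemma pair_subset_lettersAt (j : ZMod r) :
    {a j, invLetter (a (j - 1))} ⊆ lettersAt a x (x j) := by
  rintro c (rfl | rfl)
  · exact ⟨j, Or.inl ⟨rfl, rfl⟩⟩
  · exact ⟨j - 1, Or.inr ⟨by rw [sub_add_cancel], rfl⟩⟩

lemma IsCyclicReduced.ne_inv_pred (hr : IsCyclicReduced a) (j : ZMod r) :
    a j ≠ invLetter (a (j - 1)) := by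
  have := hr (j - 1)
  rwa [sub_add_cancel] at this

lemma two_le_ncard_lettersAt [Finite C] (hr : IsCyclicReduced a) (j : ZMod r) :
    2 ≤ (lettersAt a x (x j)).ncard := by
  rw [← Set.ncard_pair (hr.ne_inv_pred j)]
  exact Set.ncard_le_ncard (pair_subset_lettersAt j)

/-- A coherent closed walk reading a cyclically reduced word is not a tree. -/
lemma card_le_sum_numEdges [Fintype C] [Fintype V] (hx : Function.Surjective x)
    (h : IsCoherent a x) (hr : IsCyclicReduced a) :
    Fintype.card V ≤ ∑ i, numEdges a x i := by
  have h1 := sum_ncard_lettersAt h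
  have h2 : ∑ _v : V, 2 ≤ ∑ v, (lettersAt a x v).ncard :=
    Finset.sum_le_sum fun v _ => by
      obtain ⟨j, rfl⟩ := hx v
      exact two_le_ncard_lettersAt hr j
  simp only [Finset.sum_const, Finset.card_univ, smul_eq_mul] at h2
  omega

/-- Equality in the double count forces exactly two letters at every vertex: the outgoing one and
the inverse of the incoming one. -/
lemma lettersAt_eq_pair [Fintype C] [Fintype V] (hx : Function.Surjective x)
    (h : IsCoherent a x) (hr : IsCyclicReduced a)
    (hV : Fintype.card V = ∑ i, numEdges a x i) (j : ZMod r) :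
    lettersAt a x (x j) = {a j, invLetter (a (j - 1))} := by
  have h1 := sum_ncard_lettersAt h
  have h2 : ∑ _v : V, 2 = ∑ v, (lettersAt a x v).ncard := by
    simp only [Finset.sum_const, Finset.card_univ, smul_eq_mul]
    omega
  have h3 := (Finset.sum_eq_sum_iff_of_le (fun v _ => by
      obtain ⟨j, rfl⟩ := hx v
      exact two_le_ncard_lettersAt hr j)).1 h2 (x j) (Finset.mem_univ _)
  symm
  refine Set.eq_of_subset_of_ncard_le (pair_subset_lettersAt j) ?_
  rw [Set.ncard_pair (hr.ne_inv_pred j), ← h3]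

/-- In a unicyclic coherent walk, two visits to the same vertex read the same letter. -/
lemma letter_eq_of_eq [NeZero r] [Fintype C] [Fintype V] (hx : Function.Surjective x)
    (h : IsCoherent a x) (hr : IsCyclicReduced a)
    (hV : Fintype.card V = ∑ i, numEdges a x i) {j j' : ZMod r} (hj : x j = x j') :
    a j = a j' := by
  have pair := lettersAt_eq_pair hx h hr hV
  by_contra hne
  -- If the letters differ, the walk leaving time `j` must retrace backwards the walk that arrived
  -- at time `j'`, and it can never stop retracing.
  have key : ∀ t : ℕ, x (j + t) = x (j' - t) ∧ a (j + t) = invLetter (a (j' - t - 1)) := by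
    intro t
    induction t with
    | zero =>
      have h1 : a j ∈ lettersAt a x (x j') := by rw [← hj, pair]; simp
      rw [pair] at h1
      rcases h1 with h1 | h1
      · exact absurd h1 hne
      · simpa using ⟨hj, h1⟩
    | succ t ih =>
      obtain ⟨h1, h2⟩ := ih
      have e1 : j + ((t + 1 : ℕ) : ZMod r) = j + t + 1 := by push_cast; ring
      have e2 : j' - ((t + 1 : ℕ) : ZMod r) = j' - t - 1 := by push_cast; ring
      rw [e1, e2]
      have h3 : x (j + t + 1) = x (j' - t - 1) := by
        refine (h.next_iff_of_inv h2).1 ?_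
        rwa [sub_add_cancel]
      refine ⟨h3, ?_⟩
      have h4 : a (j + t + 1) ∈ lettersAt a x (x (j' - t - 1)) := by rw [← h3, pair]; simp
      rw [pair] at h4
      rcases h4 with h4 | h4
      · exfalso
        refine hr (j + t) ?_
        rw [h4, h2, invLetter_invLetter]
      · exact h4
  -- The forward and the backward walk meet halfway between `j` and `j'`. An even distance gives a
  -- letter followed by its inverse, an odd one a letter equal to its inverse.
  obtain ⟨s, hs | hs⟩ := Nat.even_or_odd' (j' - j).val
  · have h5 : j' = j + s + s := by
      have : ((j' - j).val : ZMod r) = j' - j := ZMod.natCast_zmod_val _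
      rw [hs] at this
      push_cast at this
      linear_combination -this
    have := (key s).2
    rw [h5, show j + s + s - (s : ZMod r) - 1 = j + s - 1 by ring] at this
    exact hr.ne_inv_pred _ this
  · have h5 : j' = j + s + s + 1 := by
      have : ((j' - j).val : ZMod r) = j' - j := ZMod.natCast_zmod_val _
      rw [hs] at this
      push_cast at this
      linear_combination -this
    have := (key s).2
    rw [h5, show j + s + s + 1 - (s : ZMod r) - 1 = j + s by ring] at this
    exact invLetter_ne _ this.symm

/-- In a unicyclic coherent walk, two visits to the same vertex have the same continuation. -/
lemma shift_eq_of_eq [NeZero r] [Fintype C] [Fintype V] (hx : Function.Surjective x)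
    (h : IsCoherent a x) (hr : IsCyclicReduced a)
    (hV : Fintype.card V = ∑ i, numEdges a x i) {j j' : ZMod r} (hj : x j = x j')
    (t : ZMod r) : x (j + t) = x (j' + t) ∧ a (j + t) = a (j' + t) := by
  suffices H : ∀ t : ℕ, x (j + t) = x (j' + t) by
    have := H t.val
    rw [ZMod.natCast_zmod_val] at this
    exact ⟨this, letter_eq_of_eq hx h hr hV this⟩
  intro t
  induction t with
  | zero => simpa using hj
  | succ t ih =>
    have := (h.next_iff (letter_eq_of_eq hx h hr hV ih)).1 ih
    push_cast
    rwa [← add_assoc, ← add_assoc]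

/-! ### Invariance under relabelling -/

lemma stepSource_eq_iff (hxy : ∀ j j', x j = x j' ↔ y j = y j') (j j' : ZMod r) :
    stepSource a x j = stepSource a x j' ↔ stepSource a y j = stepSource a y j' := by
  unfold stepSource
  split_ifs <;> exact hxy _ _

lemma stepTarget_eq_iff (hxy : ∀ j j', x j = x j' ↔ y j = y j') (j j' : ZMod r) :
    stepTarget a x j = stepTarget a x j' ↔ stepTarget a y j = stepTarget a y j' := by
  unfold stepTarget
  split_ifs <;> exact hxy _ _

lemma isCoherent_iff (hxy : ∀ j j', x j = x j' ↔ y j = y j') :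
    IsCoherent a x ↔ IsCoherent a y := by
  unfold IsCoherent
  simp only [stepSource_eq_iff hxy, stepTarget_eq_iff hxy]

lemma numEdges_congr (hxy : ∀ j j', x j = x j' ↔ y j = y j') (i : C) :
    numEdges a x i = numEdges a y i :=
  ncard_image_congr _ fun _ _ _ _ => stepSource_eq_iff hxy _ _

lemma GraphEquiv.symm {g : Digraph V} {g' : Digraph W} (h : GraphEquiv g g') :
    GraphEquiv g' g := by
  obtain ⟨e⟩ := h
  exact ⟨e.symm⟩

lemma GraphEquiv.trans {U : Type*} {g : Digraph U} {g' : Digraph V} {g'' : Digraph W}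
    (h : GraphEquiv g g') (h' : GraphEquiv g' g'') : GraphEquiv g g'' := by
  obtain ⟨e⟩ := h
  obtain ⟨f⟩ := h'
  exact ⟨e.trans f⟩

/-- A graph is equivalent to its image under an injective map. -/
lemma GraphEquiv.of_injective {g : Digraph V} {g' : Digraph W} (φ : V → W)
    (hφ : Function.Injective φ)
    (h : ∀ u v, g'.Adj u v ↔ ∃ u' v', φ u' = u ∧ φ v' = v ∧ g.Adj u' v') :
    GraphEquiv g g' := by
  have hadj : ∀ u v, g'.Adj (φ u) (φ v) ↔ g.Adj u v := by
    intro u v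
    rw [h]
    constructor
    · rintro ⟨u', v', hu, hv, huv⟩
      rwa [← hφ hu, ← hφ hv]
    · exact fun huv => ⟨u, v, rfl, rfl, huv⟩
  have hni : ∀ u, NonIsolated g u → NonIsolated g' (φ u) := by
    rintro u ⟨v, hv⟩
    exact ⟨φ v, by rwa [hadj, hadj]⟩
  refine ⟨⟨Equiv.ofBijective (fun u : {u // NonIsolated g u} =>
    (⟨φ u.1, hni _ u.2⟩ : {u // NonIsolated g' u})) ⟨?_, ?_⟩, ?_⟩⟩
  · intro u v e
    exact Subtype.ext (hφ (congrArg Subtype.val e))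
  · rintro ⟨w, v, hv | hv⟩
    · obtain ⟨u', v', rfl, rfl, huv⟩ := (h _ _).1 hv
      exact ⟨⟨u', v', Or.inl huv⟩, rfl⟩
    · obtain ⟨u', v', rfl, rfl, huv⟩ := (h _ _).1 hv
      exact ⟨⟨v', u', Or.inr huv⟩, rfl⟩
  · rintro ⟨u, hu⟩ ⟨v, hv⟩
    exact hadj u v

lemma walkGraph_comp (φ : V → W) (hφ : Function.Injective φ) (i : C) :
    GraphEquiv (walkGraph a x i) (walkGraph a (φ ∘ x) i) := by
  have hs : ∀ j, stepSource a (φ ∘ x) j = φ (stepSource a x j) := by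
    intro j; unfold stepSource; split_ifs <;> rfl
  have ht : ∀ j, stepTarget a (φ ∘ x) j = φ (stepTarget a x j) := by
    intro j; unfold stepTarget; split_ifs <;> rfl
  refine GraphEquiv.of_injective φ hφ fun u v => ?_
  constructor
  · rintro ⟨j, hj, rfl, rfl⟩
    exact ⟨_, _, (hs j).symm, (ht j).symm, j, hj, rfl, rfl⟩
  · rintro ⟨_, _, rfl, rfl, j, hj, rfl, rfl⟩
    exact ⟨j, hj, (hs j).symm, (ht j).symm⟩

/-- The graphs of a walk only depend on its coincidences. -/
lemma walkGraph_equiv (hxy : ∀ j j', x j = x j' ↔ y j = y j') (i : C) :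
    GraphEquiv (walkGraph a x i) (walkGraph a y i) := by
  -- Both walks are injective images of the universal walk on the classes of coinciding times.
  let φ : Quotient (Setoid.ker x) → V := Quotient.lift x fun _ _ e => e
  have hφ : Function.Injective φ := fun p q =>
    Quotient.inductionOn₂ p q fun _ _ e => Quotient.sound e
  let ψ : Quotient (Setoid.ker x) → W := Quotient.lift y fun j j' e => (hxy j j').1 e
  have hψ : Function.Injective ψ := fun p q =>
    Quotient.inductionOn₂ p q fun j j' e => Quotient.sound ((hxy j j').2 e)
  exact (walkGraph_comp (a := a) (x := Quotient.mk _) φ hφ i).symm.trans (walkGraph_comp ψ hψ i)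

lemma graphClass_eq_iff {n n' : ℕ} (g : Digraph (Fin n)) (g' : Digraph (Fin n')) :
    graphClass g = graphClass g' ↔ GraphEquiv g g' :=
  Quotient.eq (r := graphSetoid)

lemma GraphEquiv.straightClass_eq {γ : List ℕ} {n : ℕ} {g : Digraph (Fin n)}
    (h : GraphEquiv (pathForest γ) g) : graphClass g = straightClass γ := by
  rw [straightClass, graphClass_eq_iff]
  refine h.symm.trans (GraphEquiv.of_injective finSigmaFinEquiv finSigmaFinEquiv.injective ?_)
  intro u v
  constructor
  · intro huv
    exact ⟨_, _, finSigmaFinEquiv.apply_symm_apply u, finSigmaFinEquiv.apply_symm_apply v, huv⟩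
  · rintro ⟨u', v', rfl, rfl, huv⟩
    simpa using huv

end Walks

/-! ### Probability that random permutations follow a walk -/

open Nat in
lemma natCard_perm_fixing {α : Type*} [Fintype α] (T : Set α) :
    Nat.card {τ : Equiv.Perm α // ∀ v ∈ T, τ v = v} = (Fintype.card α - T.ncard)! := by
  classical
  have e : {τ : Equiv.Perm α // ∀ v ∈ T, τ v = v} ≃ Equiv.Perm {v // v ∉ T} :=
    ((Equiv.Perm.subtypeEquivSubtypePerm (fun v => v ∉ T)).trans
      (Equiv.subtypeEquivRight fun τ => by simp)).symm
  rw [Nat.card_congr e, Nat.card_perm]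
  congr 1
  have h1 : Nat.card {v // v ∉ T} = Tᶜ.ncard := rfl
  rw [h1, Set.ncard_compl, Nat.card_eq_fintype_card]

open Nat in
/-- The number of permutations extending a partial injection. -/
lemma natCard_perm_extending {ι α : Type*} [Fintype α] (s t : ι → α) (S : Set ι)
    (h : ∀ p ∈ S, ∀ q ∈ S, s p = s q ↔ t p = t q) :
    Nat.card {τ : Equiv.Perm α // ∀ p ∈ S, τ (s p) = t p}
      = (Fintype.card α - (s '' S).ncard)! := by
  classical
  -- The partial injection `s p ↦ t p` extends to a permutation; translating by its inverse reduces
  -- the count to permutations fixing `s '' S` pointwise.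
  let e : {v // v ∈ s '' S} ≃ {v // v ∈ t '' S} := Equiv.ofBijective
    (fun v => ⟨t v.2.choose, _, v.2.choose_spec.1, rfl⟩) (by
      constructor
      · intro v w hvw
        have := congrArg Subtype.val hvw
        refine Subtype.ext ?_
        rw [← v.2.choose_spec.2, ← w.2.choose_spec.2]
        exact (h _ v.2.choose_spec.1 _ w.2.choose_spec.1).2 this
      · rintro ⟨_, j, hj, rfl⟩
        have hv : s j ∈ s '' S := ⟨j, hj, rfl⟩
        exact ⟨⟨s j, hv⟩, Subtype.ext ((h _ hv.choose_spec.1 _ hj).1 hv.choose_spec.2)⟩)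
  have he : ∀ p (hp : p ∈ S), e.extendSubtype (s p) = t p := by
    intro p hp
    have hv : s p ∈ s '' S := ⟨p, hp, rfl⟩
    rw [Equiv.extendSubtype_apply_of_mem e _ hv]
    exact (h _ hv.choose_spec.1 _ hp).1 hv.choose_spec.2
  rw [← natCard_perm_fixing]
  refine Nat.card_congr ((Equiv.mulLeft (e.extendSubtype)⁻¹).subtypeEquiv fun τ => ?_)
  constructor
  · rintro hτ _ ⟨p, hp, rfl⟩
    rw [Equiv.coe_mulLeft, Equiv.Perm.mul_apply, hτ p hp, ← he p hp, Equiv.Perm.inv_eq_iff_eq]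
  · intro hτ p hp
    have := hτ (s p) ⟨p, hp, rfl⟩
    rw [Equiv.coe_mulLeft, Equiv.Perm.mul_apply, Equiv.Perm.inv_eq_iff_eq, he p hp] at this
    exact this

/-- The permutations `σ` carry the vertices of a closed walk to each other. -/
def Follows {C V : Type*} {r : ℕ} (a : ZMod r → C × Bool) (x : ZMod r → V)
    (σ : C → Equiv.Perm V) : Prop :=
  ∀ j, σ (a j).1 (stepSource a x j) = stepTarget a x j

lemma Follows.isCoherent {C V : Type*} {r : ℕ} {a : ZMod r → C × Bool} {x : ZMod r → V}
    {σ : C → Equiv.Perm V} (h : Follows a x σ) : IsCoherent a x := by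
  intro j j' hj
  rw [← h j, ← h j', hj]
  exact (Equiv.injective _).eq_iff.symm

/-- Permutations and a starting point determine the walk, so the events attached to different rooted
walks are disjoint. -/
lemma Follows.eq {C V : Type*} {r : ℕ} [NeZero r] {a : ZMod r → C × Bool} {x y : ZMod r → V}
    {σ : C → Equiv.Perm V} (hx : Follows a x σ) (hy : Follows a y σ) (h0 : x 0 = y 0) :
    x = y := by
  suffices H : ∀ t : ℕ, x t = y t by
    ext j
    rw [← ZMod.natCast_zmod_val j]
    exact H _
  intro t
  induction t with
  | zero => simpa using h0
  | succ t ih =>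
    have h1 := hx t
    have h2 := hy t
    unfold stepSource stepTarget at h1 h2
    push_cast
    split_ifs at h1 h2
    · rw [← h1, ← h2, ih]
    · exact (σ (a t).1).injective (by rw [h1, h2, ih])

/-- Grouping the constraints by colour gives one event for each permutation, the form in which
independence applies. -/
lemma follows_preimage {k N r : ℕ} {S : Type*} {ρ : Fin k → S → Equiv.Perm (Fin N)}
    {a : ZMod r → Fin k × Bool} (x : ZMod r → Fin N) :
    {s | Follows a x (fun i => ρ i s)} = ⋂ i ∈ (Finset.univ : Finset (Fin k)),
      ρ i ⁻¹' {τ | ∀ j ∈ {j | (a j).1 = i}, τ (stepSource a x j) = stepTarget a x j} := by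
  ext s
  simp only [Follows, Set.mem_ofPred_eq, Finset.mem_univ, Set.iInter_true, Set.mem_iInter,
    Set.mem_preimage]
  exact ⟨fun h i j hj => hj ▸ h j, fun h j => h _ j rfl⟩

/-! ### Independent uniform permutations -/

section Probability

variable {k N r : ℕ} {S : Type*} [MeasurableSpace S] {μ : Measure S}
  {ρ : Fin k → S → Equiv.Perm (Fin N)} {a : ZMod r → Fin k × Bool}

open Nat in
lemma real_preimage_perm {f : S → Equiv.Perm (Fin N)} (hf : Measurable f)
    (hunif : μ.map f = uniformOn Set.univ) (A : Set (Equiv.Perm (Fin N))) :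
    μ.real (f ⁻¹' A) = (Nat.card A : ℝ) / (N ! : ℝ) := by
  have hA : MeasurableSet A := trivial
  have : MeasurableSingletonClass (Equiv.Perm (Fin N)) := ⟨fun _ => trivial⟩
  rw [← map_measureReal_apply hf hA, hunif, Measure.real, uniformOn_univ]
  rw [ENNReal.toReal_div, Measure.count_apply_finite _ (Set.toFinite A),
    Fintype.card_perm, Fintype.card_fin, Nat.card_eq_card_finite_toFinset (Set.toFinite A)]
  simp

lemma measurableSet_follows (hmeas : ∀ i, Measurable (ρ i)) (x : ZMod r → Fin N) :
    MeasurableSet {s | Follows a x (fun i => ρ i s)} := by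
  rw [follows_preimage]
  exact Finset.measurableSet_biInter _ fun i _ => hmeas i trivial

open Nat in
lemma real_follows (hmeas : ∀ i, Measurable (ρ i))
    (hunif : ∀ i, μ.map (ρ i) = uniformOn Set.univ) (hindep : iIndepFun ρ μ)
    {x : ZMod r → Fin N} (hx : IsCoherent a x) :
    μ.real {s | Follows a x (fun i => ρ i s)}
      = ∏ i, (((N - numEdges a x i)! : ℕ) : ℝ) / (N ! : ℝ) := by
  rw [follows_preimage, Measure.real, hindep.measure_inter_preimage_eq_mul _ (fun _ _ => trivial),
    ENNReal.toReal_prod]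
  refine Finset.prod_congr rfl fun i _ => ?_
  have := real_preimage_perm (hmeas i) (hunif i)
    {τ | ∀ j ∈ {j | (a j).1 = i}, τ (stepSource a x j) = stepTarget a x j}
  rw [Measure.real] at this
  rw [this]
  congr 2
  have := natCard_perm_extending (stepSource a x) (stepTarget a x) {j | (a j).1 = i}
    (fun p hp q hq => hx p q (hp.trans hq.symm))
  rw [Fintype.card_fin] at this
  exact this

end Probability

/-! ### Counting walks with given coincidences -/

/-- A map with kernel `K` is the same thing as an injection of the quotient by `K`. -/
lemma card_walks_ker {Z α : Type*} [Fintype Z] [DecidableEq Z] [Fintype α]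
    (K : Setoid Z) :
    Nat.card {x : Z → α // Setoid.ker x = K}
      = (Nat.card α).descFactorial (Nat.card (Quotient K)) := by
  classical
  have e : {x : Z → α // Setoid.ker x = K} ≃ (Quotient K ↪ α) :=
    { toFun := fun x => ⟨Quotient.lift x.1 fun p q h => by
          have h' : K p q := h
          rw [← x.2] at h'
          exact h', fun p q => Quotient.inductionOn₂ p q fun p q h => Quotient.sound (by
            have h' : Setoid.ker x.1 p q := h
            rw [x.2] at h'
            exact h')⟩
      invFun := fun φ => ⟨fun z => φ (Quotient.mk K z), by
        ext p q
        rw [Setoid.ker_def, φ.injective.eq_iff]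
        exact Quotient.eq⟩
      left_inv := fun x => rfl
      right_inv := fun φ => by
        ext q
        induction q using Quotient.inductionOn
        rfl }
  rw [Nat.card_congr e, Nat.card_eq_fintype_card, Fintype.card_embedding_eq,
    Nat.card_eq_fintype_card, Nat.card_eq_fintype_card]

/-- A transposition moves the starting point to `0` without changing the pattern, so every starting
point accounts for equally many walks. The factor `n + 1` is the one in front of the probability in
the theorem. -/
lemma card_rooted_walks_ker {Z : Type*} [Fintype Z] [DecidableEq Z] {n : ℕ} (K : Setoid Z)
    (z : Z) :
    (n + 1) * Nat.card {x : Z → Fin (n + 1) // x z = 0 ∧ Setoid.ker x = K}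
      = (n + 1).descFactorial (Nat.card (Quotient K)) := by
  classical
  have h := card_walks_ker (α := Fin (n + 1)) K
  rw [Nat.card_eq_fintype_card (α := Fin (n + 1)), Fintype.card_fin] at h
  rw [← h]
  have e : {x : Z → Fin (n + 1) // Setoid.ker x = K} ≃
      Fin (n + 1) × {x : Z → Fin (n + 1) // x z = 0 ∧ Setoid.ker x = K} :=
    { toFun := fun x => (x.1 z, ⟨Equiv.swap 0 (x.1 z) ∘ x.1, by simp, by
        refine Eq.trans ?_ x.2
        ext p q
        simp [Setoid.ker_def]⟩)
      invFun := fun p => ⟨Equiv.swap 0 p.1 ∘ p.2.1, by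
        refine Eq.trans ?_ p.2.2.2
        ext u v
        simp [Setoid.ker_def]⟩
      left_inv := fun x => by
        ext q : 2
        simp
      right_inv := fun p => by
        obtain ⟨m, x, hx, hK⟩ := p
        simp only [Function.comp_apply, hx, Equiv.swap_apply_left, Prod.mk.injEq, true_and]
        ext q : 2
        simp }
  rw [Nat.card_congr e, Nat.card_prod]
  simp

/-- There are finitely many patterns, and they do not depend on `n`, so the limit can be taken term
by term. -/
instance {Z : Type*} [Finite Z] : Finite (Setoid Z) :=
  Finite.of_injective (fun K : Setoid Z => (fun p q => K p q : Z → Z → Prop)) fun K K' h =>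
    Setoid.ext fun p q => by
      have := congrFun (congrFun h p) q
      exact iff_of_eq this

/-! ### Asymptotics -/

lemma tendsto_descFactorial_div_pow (v : ℕ) :
    Tendsto (fun n : ℕ => ((n + 1).descFactorial v : ℝ) / ((n + 1 : ℕ) : ℝ) ^ v) atTop (𝓝 1) := by
  have h := isEquivalent_descFactorial v
  rw [Asymptotics.isEquivalent_iff_tendsto_one] at h
  · exact h.comp (tendsto_add_atTop_nat 1)
  · filter_upwards [eventually_gt_atTop 0] with n hn
    positivity

open Nat in
lemma tendsto_descFactorial_mul_prod {ι : Type*} [Fintype ι] (v : ℕ) (e : ι → ℕ)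
    (h : v ≤ ∑ i, e i) :
    Tendsto (fun n : ℕ => ((n + 1).descFactorial v : ℝ) *
      ∏ i, (((n + 1 - e i)! : ℕ) : ℝ) / ((n + 1)! : ℝ)) atTop
      (𝓝 (if v = ∑ i, e i then 1 else 0)) := by
  have h1 : ∀ᶠ n : ℕ in atTop, ((n + 1).descFactorial v : ℝ) *
      ∏ i, (((n + 1 - e i)! : ℕ) : ℝ) / ((n + 1)! : ℝ)
      = (((n + 1).descFactorial v : ℝ) / ((n + 1 : ℕ) : ℝ) ^ v) *
        (∏ i, (((n + 1).descFactorial (e i) : ℝ) / ((n + 1 : ℕ) : ℝ) ^ e i)⁻¹) *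
        (((n + 1 : ℕ) : ℝ)⁻¹) ^ (∑ i, e i - v) := by
    -- The truncated subtraction in `(n + 1 - e i)!` is genuine only from this point on.
    have h2 : ∀ᶠ n : ℕ in atTop, ∀ i, e i ≤ n + 1 := by
      refine eventually_all.2 fun i => ?_
      filter_upwards [eventually_ge_atTop (e i)] with n hn
      omega
    filter_upwards [h2] with n hn
    have h3 : ∀ i, (((n + 1 - e i)! : ℕ) : ℝ) / ((n + 1)! : ℝ)
        = (((n + 1).descFactorial (e i) : ℝ) / ((n + 1 : ℕ) : ℝ) ^ e i)⁻¹ *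
          (((n + 1 : ℕ) : ℝ)⁻¹) ^ e i := by
      intro i
      have hpos : (0 : ℝ) < (n + 1).descFactorial (e i) := by
        exact_mod_cast Nat.descFactorial_pos.2 (hn i)
      have hf : (0 : ℝ) < ((n + 1 - e i)! : ℕ) := by exact_mod_cast Nat.factorial_pos _
      rw [← Nat.factorial_mul_descFactorial (hn i)]
      have hN : ((n + 1 : ℕ) : ℝ) ^ e i ≠ 0 := by positivity
      rw [Nat.cast_mul, inv_pow]
      field_simp
    rw [Finset.prod_congr rfl fun i _ => h3 i, Finset.prod_mul_distrib, Finset.prod_pow_eq_pow_sum]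
    have h4 : (((n + 1 : ℕ) : ℝ)⁻¹) ^ (∑ i, e i)
        = (((n + 1 : ℕ) : ℝ)⁻¹) ^ v * (((n + 1 : ℕ) : ℝ)⁻¹) ^ (∑ i, e i - v) := by
      rw [← pow_add, Nat.add_sub_cancel' h]
    rw [h4, div_eq_mul_inv, inv_pow]
    ring
  refine Tendsto.congr' (h1.mono fun _ hn => hn.symm) ?_
  have h5 : Tendsto (fun n : ℕ =>
      ∏ i, (((n + 1).descFactorial (e i) : ℝ) / ((n + 1 : ℕ) : ℝ) ^ e i)⁻¹) atTop (𝓝 1) := by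
    have := tendsto_finsetProd (Finset.univ : Finset ι) (fun i _ =>
      (tendsto_descFactorial_div_pow (e i)).inv₀ one_ne_zero)
    simpa using this
  have h6 : Tendsto (fun n : ℕ => (((n + 1 : ℕ) : ℝ)⁻¹) ^ (∑ i, e i - v)) atTop
      (𝓝 (if v = ∑ i, e i then 1 else 0)) := by
    split_ifs with hv
    · simp [hv]
    · have h7 : Tendsto (fun n : ℕ => ((n + 1 : ℕ) : ℝ)⁻¹) atTop (𝓝 0) :=
        (tendsto_inv_atTop_nhds_zero_nat (𝕜 := ℝ)).comp (tendsto_add_atTop_nat 1)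
      have := h7.pow (∑ i, e i - v)
      rwa [zero_pow (by omega)] at this
  simpa using ((tendsto_descFactorial_div_pow v).mul h5).mul h6

/-! ### The limit as a sum over coincidence patterns -/

/-- A coincidence pattern of closed walks is tight if it gives as many edges as vertices. -/
def IsTight {C : Type*} [Fintype C] {r : ℕ} (a : ZMod r → C × Bool) (K : Setoid (ZMod r)) :
    Prop :=
  IsCoherent a (Quotient.mk K) ∧ Nat.card (Quotient K) = ∑ i, numEdges a (Quotient.mk K) i

-- The event is a disjoint union over rooted walks. The probability of following a walk depends only
-- on its kernel `K`, hence may be computed from the universal walk `Quotient.mk K`; it remains to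
-- count the walks with this kernel.
open Classical Nat in
lemma succ_mul_real_exists_walk {k n r : ℕ} [NeZero r] {S : Type*} [MeasurableSpace S]
    {μ : Measure S} [IsProbabilityMeasure μ] {ρ : Fin k → S → Equiv.Perm (Fin (n + 1))}
    (a : ZMod r → Fin k × Bool) (P : Setoid (ZMod r) → Prop)
    [Fintype (Setoid (ZMod r))]
    (hmeas : ∀ i, Measurable (ρ i))
    (hunif : ∀ i, μ.map (ρ i) = uniformOn Set.univ) (hindep : iIndepFun ρ μ) :
    ((n + 1 : ℕ) : ℝ) * μ.real {s | ∃ x : ZMod r → Fin (n + 1), x 0 = 0 ∧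
        Follows a x (fun i => ρ i s) ∧ P (Setoid.ker x)}
      = ∑ K : Setoid (ZMod r), if P K ∧ IsCoherent a (Quotient.mk K) then
          ((n + 1).descFactorial (Nat.card (Quotient K)) : ℝ) *
            ∏ i, (((n + 1 - numEdges a (Quotient.mk K) i)! : ℕ) : ℝ) / ((n + 1)! : ℝ)
        else 0 := by
  have h1 : {s | ∃ x : ZMod r → Fin (n + 1), x 0 = 0 ∧
        Follows a x (fun i => ρ i s) ∧ P (Setoid.ker x)}
      = ⋃ x ∈ Finset.univ.filter (fun x : ZMod r → Fin (n + 1) => x 0 = 0 ∧ P (Setoid.ker x)),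
        {s | Follows a x (fun i => ρ i s)} := by
    ext s
    simp only [Set.mem_ofPred_eq, Finset.mem_filter, Finset.mem_univ, true_and, Set.mem_iUnion,
      exists_prop]
    exact exists_congr fun x => by tauto
  rw [h1, measureReal_biUnion_finset]
  rotate_left
  · intro x hx y hy hxy
    rw [Finset.mem_coe, Finset.mem_filter] at hx hy
    refine Set.disjoint_left.2 fun s hs hs' => hxy ?_
    exact Follows.eq (σ := fun i => ρ i s) hs hs' (hx.2.1.trans hy.2.1.symm)
  · exact fun x _ => measurableSet_follows hmeas x
  have h2 : ∀ x : ZMod r → Fin (n + 1), μ.real {s | Follows a x (fun i => ρ i s)}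
      = if IsCoherent a (Quotient.mk (Setoid.ker x)) then
        ∏ i, (((n + 1 - numEdges a (Quotient.mk (Setoid.ker x)) i)! : ℕ) : ℝ) / ((n + 1)! : ℝ)
        else 0 := by
    intro x
    have hx : ∀ j j', x j = x j' ↔
        Quotient.mk (Setoid.ker x) j = Quotient.mk (Setoid.ker x) j' := by
      intro j j'
      exact (Quotient.eq (r := Setoid.ker x)).symm
    split_ifs with hc
    · rw [real_follows hmeas hunif hindep ((isCoherent_iff hx).2 hc)]
      simp_rw [numEdges_congr hx]
    -- Permutations can only follow coherent walks, so here the event is empty.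
    · rw [← isCoherent_iff hx] at hc
      convert measureReal_empty (μ := μ)
      exact Set.eq_empty_of_forall_notMem fun s hs => hc (Follows.isCoherent (σ := fun i => ρ i s) hs)
  simp_rw [h2]
  rw [← Finset.sum_fiberwise (s := Finset.univ.filter _) (g := fun x => Setoid.ker x),
    Finset.mul_sum]
  refine Finset.sum_congr rfl fun K _ => ?_
  have h3 : ∀ x ∈ (Finset.univ.filter
      (fun x : ZMod r → Fin (n + 1) => x 0 = 0 ∧ P (Setoid.ker x))).filter
      (fun x => Setoid.ker x = K),
      (if IsCoherent a (Quotient.mk (Setoid.ker x)) then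
        ∏ i, (((n + 1 - numEdges a (Quotient.mk (Setoid.ker x)) i)! : ℕ) : ℝ) / ((n + 1)! : ℝ)
        else 0)
      = (if IsCoherent a (Quotient.mk K) then
        ∏ i, (((n + 1 - numEdges a (Quotient.mk K) i)! : ℕ) : ℝ) / ((n + 1)! : ℝ)
        else 0) := by
    intro x hx
    rw [Finset.mem_filter] at hx
    obtain ⟨_, rfl⟩ := hx
    rfl
  rw [Finset.sum_congr rfl h3, Finset.sum_const, nsmul_eq_mul]
  by_cases hP : P K
  · have h4 : ((Finset.univ.filter
        (fun x : ZMod r → Fin (n + 1) => x 0 = 0 ∧ P (Setoid.ker x))).filter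
        (fun x => Setoid.ker x = K)).card
        = Nat.card {x : ZMod r → Fin (n + 1) // x 0 = 0 ∧ Setoid.ker x = K} := by
      rw [Nat.card_eq_fintype_card, Fintype.card_subtype, Finset.filter_filter]
      congr 1
      refine Finset.filter_congr fun x _ => ?_
      constructor
      · rintro ⟨⟨h, -⟩, h'⟩
        exact ⟨h, h'⟩
      · rintro ⟨h, rfl⟩
        exact ⟨⟨h, hP⟩, rfl⟩
    rw [h4, ← mul_assoc, ← Nat.cast_mul, card_rooted_walks_ker]
    by_cases hc : IsCoherent a (Quotient.mk K) <;> simp [hP, hc]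
  · have h4 : ((Finset.univ.filter
        (fun x : ZMod r → Fin (n + 1) => x 0 = 0 ∧ P (Setoid.ker x))).filter
        (fun x => Setoid.ker x = K)) = ∅ := by
      refine Finset.eq_empty_of_forall_notMem fun x hx => ?_
      simp only [Finset.mem_filter] at hx
      exact hP (hx.2 ▸ hx.1.2.2)
    simp [h4, hP]

open Classical in
/-- Only the tight coincidence patterns contribute to the limit, each of them `1`. -/
theorem tendsto_succ_mul_real_exists_walk {k r : ℕ} [NeZero r] (a : ZMod r → Fin k × Bool)
    (hr : IsCyclicReduced a) (P : Setoid (ZMod r) → Prop)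
    [Fintype (Setoid (ZMod r))]
    {S : ℕ → Type*} [∀ n, MeasurableSpace (S n)] {μ : ∀ n, Measure (S n)}
    [∀ n, IsProbabilityMeasure (μ n)]
    {ρ : ∀ n, Fin k → S n → Equiv.Perm (Fin (n + 1))}
    (hmeas : ∀ n i, Measurable (ρ n i))
    (hunif : ∀ n i, (μ n).map (ρ n i) = uniformOn Set.univ)
    (hindep : ∀ n, iIndepFun (ρ n) (μ n)) :
    Tendsto (fun n : ℕ => ((n + 1 : ℕ) : ℝ) *
      (μ n).real {s | ∃ x : ZMod r → Fin (n + 1), x 0 = 0 ∧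
        Follows a x (fun i => ρ n i s) ∧ P (Setoid.ker x)}) atTop
      (𝓝 (∑ K : Setoid (ZMod r), if P K ∧ IsTight a K then 1 else 0)) := by
  simp_rw [fun n => succ_mul_real_exists_walk a P (hmeas n) (hunif n) (hindep n)]
  refine tendsto_finsetSum _ fun K _ => ?_
  by_cases hP : P K
  · by_cases hc : IsCoherent a (Quotient.mk K)
    · have h1 := card_le_sum_numEdges Quotient.mk_surjective hc hr
      rw [← Nat.card_eq_fintype_card] at h1
      simpa [hP, hc, IsTight] using tendsto_descFactorial_mul_prod _ _ h1
    · simp [hP, hc, IsTight]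
  · simp [hP]

/-! ### The trajectory as a closed walk -/

section Trajectory

variable {k : ℕ} {w : FreeGroup (Fin k)}

/-- The letters of a word in the order in which they act, indexed cyclically. -/
def cyclicLetter (w : FreeGroup (Fin k)) [NeZero (letters w).length]
    (j : ZMod (letters w).length) : Fin k × Bool :=
  (letters w)[j.val]'(ZMod.val_lt j)

lemma wordMap_eq_foldl {n : ℕ} (σ : Fin k → Equiv.Perm (Fin n)) (m : Fin n) :
    wordMap w σ m = (letters w).foldl (fun x a => letterPerm σ a x) m := by
  unfold wordMap letters
  conv_lhs => rw [← FreeGroup.mk_toWord (x := w)]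
  rw [FreeGroup.lift_mk, List.foldl_reverse]
  generalize w.toWord = U
  induction U with
  | nil => rfl
  | cons c U ih =>
    rw [List.map_cons, List.prod_cons, Equiv.Perm.mul_apply, ih, List.foldr_cons]
    unfold letterPerm
    cases c.2 <;> rfl

lemma trajectory_length {n : ℕ} (σ : Fin k → Equiv.Perm (Fin n)) (m : Fin n) :
    trajectory w σ m (letters w).length = wordMap w σ m := by
  rw [wordMap_eq_foldl, trajectory, List.take_length]

lemma trajectory_succ {n : ℕ} (σ : Fin k → Equiv.Perm (Fin n)) (m : Fin n) {t : ℕ}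
    (ht : t < (letters w).length) :
    trajectory w σ m (t + 1) = letterPerm σ (letters w)[t] (trajectory w σ m t) := by
  rw [trajectory, trajectory, ← List.take_append_getElem ht, List.foldl_append]
  rfl

variable [NeZero (letters w).length]

lemma follows_iff_letterPerm {n : ℕ} {σ : Fin k → Equiv.Perm (Fin n)} {r : ℕ}
    {a : ZMod r → Fin k × Bool} {x : ZMod r → Fin n} :
    Follows a x σ ↔ ∀ j, x (j + 1) = letterPerm σ (a j) (x j) := by
  refine forall_congr' fun j => ?_
  unfold stepSource stepTarget letterPerm
  split_ifs
  · exact eq_comm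
  · rw [Equiv.Perm.eq_inv_iff_eq]

lemma Follows.trajectory_eq {n : ℕ} {σ : Fin k → Equiv.Perm (Fin n)}
    {x : ZMod (letters w).length → Fin n} (h : Follows (cyclicLetter w) x σ) {t : ℕ}
    (ht : t ≤ (letters w).length) : trajectory w σ (x 0) t = x t := by
  induction t with
  | zero => simp [trajectory]
  | succ t ih =>
    rw [trajectory_succ _ _ ht, ih (by omega)]
    push_cast
    rw [follows_iff_letterPerm.1 h t]
    congr
    exact (ZMod.val_cast_of_lt ht).symm

lemma Follows.wordMap_eq {n : ℕ} {σ : Fin k → Equiv.Perm (Fin n)}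
    {x : ZMod (letters w).length → Fin n} (h : Follows (cyclicLetter w) x σ) :
    wordMap w σ (x 0) = x 0 := by
  rw [← trajectory_length, h.trajectory_eq le_rfl, ZMod.natCast_self]

lemma Follows.trajGraph_eq {n : ℕ} {σ : Fin k → Equiv.Perm (Fin n)}
    {x : ZMod (letters w).length → Fin n} (h : Follows (cyclicLetter w) x σ) (i : Fin k) :
    trajGraph w σ (x 0) i = walkGraph (cyclicLetter w) x i := by
  ext u v
  have key : ∀ t (ht : t < (letters w).length),
      cyclicLetter w t = (letters w)[t] ∧ trajectory w σ (x 0) t = x t ∧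
        trajectory w σ (x 0) (t + 1) = x (t + 1) := by
    intro t ht
    refine ⟨?_, h.trajectory_eq ht.le, ?_⟩
    · unfold cyclicLetter
      congr
      exact ZMod.val_cast_of_lt ht
    · rw [h.trajectory_eq ht]
      push_cast
      rfl
  constructor
  · rintro ⟨t, ⟨ht, rfl, rfl⟩ | ⟨ht, rfl, rfl⟩⟩ <;>
    · obtain ⟨hlt, ht⟩ := List.getElem?_eq_some_iff.1 ht
      obtain ⟨h1, h2, h3⟩ := key t hlt
      rw [ht] at h1
      exact ⟨t, by rw [h1], by simp [stepSource, h1, h2, h3], by simp [stepTarget, h1, h2, h3]⟩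
  · rintro ⟨j, hj, rfl, rfl⟩
    obtain ⟨h1, h2, h3⟩ := key j.val (ZMod.val_lt j)
    rw [ZMod.natCast_zmod_val] at h1 h2 h3
    refine ⟨j.val, ?_⟩
    rw [List.getElem?_eq_getElem (ZMod.val_lt j), ← h1, h2, h3]
    unfold stepSource stepTarget
    rcases hb : cyclicLetter w j with ⟨c, b⟩
    rw [hb] at hj
    cases hj
    cases b <;> simp

lemma follows_trajectory {n : ℕ} {σ : Fin k → Equiv.Perm (Fin n)} {m : Fin n}
    (h : wordMap w σ m = m) :
    Follows (cyclicLetter w) (fun j => trajectory w σ m j.val) σ := by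
  rw [follows_iff_letterPerm]
  intro j
  have h1 := trajectory_succ σ m (ZMod.val_lt j)
  rw [cyclicLetter, ← h1]
  rcases (Nat.succ_le_of_lt (ZMod.val_lt j)).lt_or_eq with h2 | h2
  · have h3 : (j + 1).val = j.val + 1 := by
      rw [← Nat.succ_eq_add_one, ← ZMod.val_cast_of_lt h2]
      push_cast
      rw [ZMod.natCast_zmod_val]
    rw [h3]
  -- At the last step the index wraps around to `0`, and the walk closes up because `w` fixes `m`.
  · have h3 : j + 1 = 0 := by
      have : (((j.val + 1 : ℕ)) : ZMod (letters w).length) = 0 := by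
        rw [← Nat.succ_eq_add_one, h2, ZMod.natCast_self]
      push_cast at this
      rwa [ZMod.natCast_zmod_val] at this
    rw [h3, ← Nat.succ_eq_add_one, h2, trajectory_length, h]
    simp [trajectory]

/-- A point is fixed by `w`, with prescribed trajectory graphs, if and only if a closed walk
starts there. -/
lemma trajectory_event_iff {n : ℕ} (σ : Fin k → Equiv.Perm (Fin n)) (m : Fin n)
    (g : Fin k → GraphClass) :
    ((∀ i, graphClass (trajGraph w σ m i) = g i) ∧ cycleLength (wordMap w σ) m = 1) ↔
      ∃ x : ZMod (letters w).length → Fin n, x 0 = m ∧ Follows (cyclicLetter w) x σ ∧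
        ∀ i, graphClass (walkGraph (cyclicLetter w) x i) = g i := by
  rw [cycleLength, Function.minimalPeriod_eq_one_iff_isFixedPt]
  constructor
  · rintro ⟨hg, hm⟩
    have h := follows_trajectory (w := w) hm
    have h0 : trajectory w σ m (0 : ZMod (letters w).length).val = m := by simp [trajectory]
    refine ⟨_, h0, h, fun i => ?_⟩
    rw [← hg i, ← h.trajGraph_eq i, h0]
  · rintro ⟨x, rfl, h, hg⟩
    exact ⟨fun i => by rw [h.trajGraph_eq, hg], h.wordMap_eq⟩

end Trajectory

/-! ### Cyclic walks -/

section Cycle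

variable {C : Type*} {p r : ℕ} {b : ZMod p → C × Bool} {a : ZMod r → C × Bool}

/-- Two edges of one colour and opposite signs sharing a source would be crossed at consecutive
steps, by a letter and its inverse. The same argument works for targets. -/
lemma stepSource_id_injective (hb : IsCyclicReduced b) {u v : ZMod p} (hc : (b u).1 = (b v).1)
    (h : stepSource b id u = stepSource b id v) : u = v := by
  unfold stepSource at h
  split_ifs at h with h1 h2 h2
  · exact h
  · refine absurd ?_ (hb v)
    rw [id, id] at h
    rw [← h]
    exact Prod.ext hc (by simp [invLetter, h1, h2])
  · refine absurd ?_ (hb u)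
    rw [id, id] at h
    rw [h]
    exact Prod.ext hc.symm (by simp [invLetter, h1, h2])
  · exact add_right_cancel h

lemma stepTarget_id_injective (hb : IsCyclicReduced b) {u v : ZMod p} (hc : (b u).1 = (b v).1)
    (h : stepTarget b id u = stepTarget b id v) : u = v := by
  unfold stepTarget at h
  split_ifs at h with h1 h2 h2
  · exact add_right_cancel h
  · refine absurd ?_ (hb u)
    rw [id, id] at h
    rw [h]
    exact Prod.ext hc.symm (by simp [invLetter, h1, h2])
  · refine absurd ?_ (hb v)
    rw [id, id] at h
    rw [← h]
    exact Prod.ext hc (by simp [invLetter, h1, h2])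
  · exact h

/-- Distinct steps around the cycle cross distinct edges, so there are as many edges as vertices;
this is what makes winding patterns tight. -/
lemma sum_numEdges_id [NeZero p] [Fintype C] (hb : IsCyclicReduced b) :
    ∑ i, numEdges b id i = p := by
  classical
  have h : ∀ i, numEdges b id i = (Finset.univ.filter fun u => (b u).1 = i).card := by
    intro i
    rw [numEdges, sources, Set.InjOn.ncard_image, ← Set.ncard_coe_finset]
    · congr 1
      ext u
      simp
    · intro u hu v hv e
      exact stepSource_id_injective hb (hu.trans hv.symm) e
  simp_rw [h]
  rw [← Finset.card_eq_sum_card_fiberwise (f := fun u => (b u).1) (s := Finset.univ)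
    (t := Finset.univ) (fun _ _ => Finset.mem_coe.2 (Finset.mem_univ _)),
    Finset.card_univ, ZMod.card]

lemma stepSource_cast (hpr : p ∣ r) (hab : ∀ j, a j = b (ZMod.cast j)) (j : ZMod r) :
    stepSource a (ZMod.cast : ZMod r → ZMod p) j = stepSource b id (ZMod.cast j) := by
  unfold stepSource
  rw [hab, ZMod.cast_add hpr, ZMod.cast_one hpr]
  rfl

lemma stepTarget_cast (hpr : p ∣ r) (hab : ∀ j, a j = b (ZMod.cast j)) (j : ZMod r) :
    stepTarget a (ZMod.cast : ZMod r → ZMod p) j = stepTarget b id (ZMod.cast j) := by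
  unfold stepTarget
  rw [hab, ZMod.cast_add hpr, ZMod.cast_one hpr]
  rfl

lemma zmodCast_surjective (hpr : p ∣ r) :
    Function.Surjective (ZMod.cast : ZMod r → ZMod p) :=
  ZMod.castHom_surjective hpr

lemma walkGraph_cast (hpr : p ∣ r) (hab : ∀ j, a j = b (ZMod.cast j)) (i : C) :
    walkGraph a (ZMod.cast : ZMod r → ZMod p) i = walkGraph b id i := by
  ext u v
  constructor
  · rintro ⟨j, hj, rfl, rfl⟩
    exact ⟨ZMod.cast j, by rw [← hab, hj], stepSource_cast hpr hab j, stepTarget_cast hpr hab j⟩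
  · rintro ⟨u, hu, rfl, rfl⟩
    obtain ⟨j, rfl⟩ := zmodCast_surjective hpr u
    exact ⟨j, by rw [hab, hu], (stepSource_cast hpr hab j).symm, (stepTarget_cast hpr hab j).symm⟩

lemma mk_ker_eq_iff {Z U : Type*} (x : Z → U) (j j' : Z) :
    x j = x j' ↔ Quotient.mk (Setoid.ker x) j = Quotient.mk (Setoid.ker x) j' :=
  (Quotient.eq (r := Setoid.ker x)).symm

/-- Winding around a shorter cycle is a tight coincidence pattern. -/
lemma isTight_ker_cast [NeZero p] [Fintype C] (hpr : p ∣ r) (hab : ∀ j, a j = b (ZMod.cast j))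
    (hb : IsCyclicReduced b) : IsTight a (Setoid.ker (ZMod.cast : ZMod r → ZMod p)) := by
  have hx := mk_ker_eq_iff (ZMod.cast : ZMod r → ZMod p)
  refine ⟨(isCoherent_iff hx).1 ?_, ?_⟩
  · intro j j' hj
    rw [stepSource_cast hpr hab, stepSource_cast hpr hab, stepTarget_cast hpr hab,
      stepTarget_cast hpr hab]
    rw [hab, hab] at hj
    constructor
    · exact fun e => by rw [stepSource_id_injective hb hj e]
    · exact fun e => by rw [stepTarget_id_injective hb hj e]
  · simp_rw [← numEdges_congr hx]
    have h : ∀ i, numEdges a (ZMod.cast : ZMod r → ZMod p) i = numEdges b id i := by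
      intro i
      unfold numEdges sources
      congr 1
      ext u
      constructor
      · rintro ⟨j, hj, rfl⟩
        exact ⟨ZMod.cast j, by rw [Set.mem_ofPred_eq, ← hab, hj], (stepSource_cast hpr hab j).symm⟩
      · rintro ⟨v, hv, rfl⟩
        obtain ⟨j, rfl⟩ := zmodCast_surjective hpr v
        exact ⟨j, by rw [Set.mem_ofPred_eq, hab, hv], stepSource_cast hpr hab j⟩
    simp_rw [h]
    rw [sum_numEdges_id hb, Nat.card_congr
      (Setoid.quotientKerEquivOfSurjective _ (zmodCast_surjective hpr)), Nat.card_zmod]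

/-- A tight coincidence pattern is the congruence modulo a period of the cyclic word. -/
lemma IsTight.exists_period [NeZero r] [Fintype C] {K : Setoid (ZMod r)} (hK : IsTight a K)
    (ha : IsCyclicReduced a) :
    ∃ p, p ∣ r ∧ (∀ j, a (j + p) = a j) ∧ K = Setoid.ker (ZMod.cast : ZMod r → ZMod p) := by
  obtain ⟨hc, hV⟩ := hK
  have := Fintype.ofFinite (Quotient K)
  rw [Nat.card_eq_fintype_card] at hV
  -- Coincidences propagate along the walk, so `K` is invariant under translation and is determined
  -- by the class of `0`.
  have hshift : ∀ {j j' : ZMod r}, K j j' → ∀ t, K (j + t) (j' + t) ∧ a (j + t) = a (j' + t) := by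
    intro j j' h t
    have := shift_eq_of_eq Quotient.mk_surjective hc ha hV (j := j) (j' := j')
      (Quotient.sound h) t
    exact ⟨Quotient.exact this.1, this.2⟩
  -- Lifted to `ℤ`, the class of `0` is generated by one integer, which divides `r` because `r`
  -- itself lies in `H`.
  let H : AddSubgroup ℤ :=
    { carrier := {t | K (t : ZMod r) 0}
      zero_mem' := by
        rw [Set.mem_ofPred_eq, Int.cast_zero]
      add_mem' := by
        intro s t hs ht
        have h1 := (hshift hs (t : ZMod r)).1
        rw [zero_add] at h1
        rw [Set.mem_ofPred_eq, Int.cast_add]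
        exact K.trans h1 ht
      neg_mem' := by
        intro s hs
        have h1 := (hshift hs (-(s : ZMod r))).1
        rw [add_neg_cancel, zero_add] at h1
        rw [Set.mem_ofPred_eq, Int.cast_neg]
        exact K.symm h1 }
  obtain ⟨c, hcH⟩ := Int.subgroup_cyclic H
  have hmem : ∀ t : ℤ, K (t : ZMod r) 0 ↔ (c.natAbs : ℤ) ∣ t := by
    intro t
    change t ∈ H ↔ _
    rw [hcH, ← AddSubgroup.zmultiples_eq_closure, Int.mem_zmultiples_iff, Int.natAbs_dvd]
  have hr0 : c.natAbs ∣ r := by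
    have := (hmem r).1 (by rw [Int.cast_natCast, ZMod.natCast_self])
    exact_mod_cast this
  refine ⟨c.natAbs, hr0, fun j => ?_, ?_⟩
  · have h1 := (hmem c.natAbs).2 dvd_rfl
    have h2 := (hshift h1 j).2
    rw [zero_add, Int.cast_natCast, add_comm] at h2
    exact h2
  · ext j j'
    have hcast : ∀ u : ZMod r, (ZMod.cast u : ZMod c.natAbs) = 0 ↔ K u 0 := by
      intro u
      have h1 := hmem u.val
      rw [Int.cast_natCast, ZMod.natCast_zmod_val] at h1
      rw [h1, ← ZMod.natCast_val, ZMod.natCast_eq_zero_iff, Int.natCast_dvd_natCast]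
    rw [Setoid.ker_def, ← sub_eq_zero, ← ZMod.cast_sub hr0, hcast]
    constructor
    · intro h
      have := (hshift h (-j')).1
      rwa [add_neg_cancel, ← sub_eq_add_neg] at this
    · intro h
      have := (hshift h j').1
      rwa [zero_add, sub_add_cancel] at this

end Cycle

/-! ### Reduced forms and spelling -/

section Spelling

variable {α : Type*}

/-- The letters of a syllable. -/
def spellSyllable (p : α × ℤ) : List (α × Bool) :=
  List.replicate p.2.natAbs (p.1, decide (0 < p.2))

/-- The letters of a product of syllables. -/
def spell (L : List (α × ℤ)) : List (α × Bool) :=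
  (L.map spellSyllable).flatten

lemma mk_spellSyllable (p : α × ℤ) :
    FreeGroup.mk (spellSyllable p) = FreeGroup.of p.1 ^ p.2 := by
  have h1 : ∀ (c : α × Bool) (n : ℕ), FreeGroup.mk (List.replicate n c) = FreeGroup.mk [c] ^ n := by
    intro c n
    rw [FreeGroup.pow_mk]
    simp
  obtain ⟨c, z⟩ := p
  rw [spellSyllable, h1]
  rcases lt_or_ge 0 z with hz | hz
  · have h2 : decide (0 < z) = true := by simpa using hz
    dsimp only
    rw [h2]
    conv_rhs => rw [← Int.natAbs_of_nonneg hz.le, zpow_natCast]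
    rfl
  · have h2 : decide (0 < z) = false := by simpa using hz
    dsimp only
    rw [h2]
    have h3 : z = -(z.natAbs : ℤ) := by omega
    conv_rhs => rw [h3, zpow_neg, zpow_natCast, ← inv_pow]
    rfl

lemma mk_spell (L : List (α × ℤ)) :
    FreeGroup.mk (spell L) = (L.map fun p => FreeGroup.of p.1 ^ p.2).prod := by
  induction L with
  | nil => rfl
  | cons p L ih =>
    rw [List.map_cons, List.prod_cons, ← ih, ← mk_spellSyllable, FreeGroup.mul_mk]
    rfl

lemma spellSyllable_ne_nil {p : α × ℤ} (hp : p.2 ≠ 0) : spellSyllable p ≠ [] := by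
  simp [spellSyllable, hp]

lemma fst_of_mem_spellSyllable {p : α × ℤ} {c : α × Bool} (h : c ∈ spellSyllable p) :
    c.1 = p.1 := by
  rw [List.eq_of_mem_replicate h]

/-- Nothing cancels inside a syllable, where all letters are equal, nor between neighbours, whose
generators differ. -/
lemma isReduced_spell {L : List (α × ℤ)} (h0 : ∀ p ∈ L, p.2 ≠ 0)
    (hL : L.IsChain (fun p q => p.1 ≠ q.1)) : FreeGroup.IsReduced (spell L) := by
  unfold FreeGroup.IsReduced spell
  rw [List.isChain_flatten]
  · constructor
    · intro l hl
      obtain ⟨p, -, rfl⟩ := List.mem_map.1 hl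
      exact List.isChain_replicate_of_rel _ fun _ => rfl
    · rw [List.isChain_map]
      refine hL.imp fun p q hpq c hc e he hce => ?_
      refine absurd ?_ hpq
      rw [← fst_of_mem_spellSyllable (List.mem_of_mem_getLast? hc),
        ← fst_of_mem_spellSyllable (List.mem_of_mem_head? he), hce]
  · intro h
    obtain ⟨p, hp, e⟩ := List.mem_map.1 h
    exact spellSyllable_ne_nil (h0 p hp) e

lemma isChain_flatten_replicate {R : α → α → Prop} {l : List α} (h : l.IsChain R)
    (hends : ∀ p ∈ l.getLast?, ∀ q ∈ l.head?, R p q) (n : ℕ) :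
    (List.replicate n l).flatten.IsChain R := by
  rcases eq_or_ne l [] with rfl | hl
  · simp
  · rw [List.isChain_flatten]
    · refine ⟨fun m hm => ?_, List.isChain_replicate_of_rel _ hends⟩
      rwa [List.eq_of_mem_replicate hm]
    · intro hm
      exact hl (List.eq_of_mem_replicate hm).symm

end Spelling

/-! ### Periods of cyclic words -/

section Periods

lemma getElem?_flatten_replicate {α : Type*} (l : List α) (q t : ℕ) (ht : t < q * l.length) :
    (List.replicate q l).flatten[t]? = l[t % l.length]? := by
  induction q generalizing t with
  | zero => simp at ht
  | succ q ih =>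
    rw [List.replicate_succ, List.flatten_cons]
    rcases lt_or_ge t l.length with h | h
    · rw [List.getElem?_append_left h, Nat.mod_eq_of_lt h]
    · rw [List.getElem?_append_right h, ih, Nat.mod_eq_sub_mod h]
      rw [add_mul, one_mul] at ht
      omega

lemma eq_flatten_replicate_take {α : Type*} (l : List α) (q g : ℕ) (hl : l.length = q * g)
    (h : ∀ t, t < l.length → l[t]? = l[t % g]?) : l = (List.replicate q (l.take g)).flatten := by
  rcases q.eq_zero_or_pos with rfl | hq
  · simpa using hl
  have hlen : (l.take g).length = g := by
    rw [List.length_take, hl]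
    exact min_eq_left (Nat.le_mul_of_pos_left g hq)
  refine List.ext_getElem? fun t => ?_
  rcases lt_or_ge t l.length with ht | ht
  · have hg : 0 < g := by
      rcases g.eq_zero_or_pos with rfl | hg
      · simp [hl] at ht
      · exact hg
    rw [getElem?_flatten_replicate _ _ _ (by rw [hlen, ← hl]; exact ht), hlen, h t ht,
      List.getElem?_take_of_lt (Nat.mod_lt t hg)]
  · rw [List.getElem?_eq_none ht, List.getElem?_eq_none]
    simpa [hlen, ← hl] using ht

variable {k : ℕ} {w : FreeGroup (Fin k)}

/-- Cyclic reducedness prevents cancellation at the seams between copies. -/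
lemma letters_pow (hw : FreeGroup.IsCyclicallyReduced w.toWord) (d : ℕ) :
    letters (w ^ d) = (List.replicate d (letters w)).flatten := by
  rw [letters, FreeGroup.toWord_pow, ((hw.flatten_replicate d).isReduced).reduce_eq, letters,
    List.reverse_flatten]
  simp

lemma length_letters_pow (hw : FreeGroup.IsCyclicallyReduced w.toWord) (d : ℕ) :
    (letters (w ^ d)).length = d * (letters w).length := by
  simp [letters_pow hw]

lemma isCyclicallyReduced_pow (hw : FreeGroup.IsCyclicallyReduced w.toWord) (d : ℕ) :
    FreeGroup.IsCyclicallyReduced (w ^ d).toWord := by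
  rw [FreeGroup.toWord_pow, ((hw.flatten_replicate d).isReduced).reduce_eq]
  exact hw.flatten_replicate d

lemma cyclicLetter_eq_some [NeZero (letters w).length] (j : ZMod (letters w).length) :
    (letters w)[j.val]? = some (cyclicLetter w j) :=
  List.getElem?_eq_getElem _

lemma cyclicLetter_natCast [NeZero (letters w).length] {t : ℕ} (ht : t < (letters w).length) :
    (letters w)[t]? = some (cyclicLetter w t) := by
  rw [← cyclicLetter_eq_some, ZMod.val_cast_of_lt ht]

/-- The cyclic word of a power covers the cyclic words of its sub-powers. -/
lemma cyclicLetter_pow_cast (hw : FreeGroup.IsCyclicallyReduced w.toWord) {h d : ℕ}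
    [NeZero (letters (w ^ d)).length] [NeZero (letters (w ^ h)).length]
    (j : ZMod (letters (w ^ d)).length) :
    cyclicLetter (w ^ d) j = cyclicLetter (w ^ h) (ZMod.cast j) := by
  have h1 := cyclicLetter_eq_some (w := w ^ d) j
  have h2 := cyclicLetter_eq_some (w := w ^ h) (ZMod.cast j)
  have h3 : (ZMod.cast j : ZMod (letters (w ^ h)).length).val
      = j.val % (letters (w ^ h)).length := by
    rw [← ZMod.natCast_val, ZMod.val_natCast]
  have h4 := ZMod.val_lt j
  have h5 := ZMod.val_lt (ZMod.cast j : ZMod (letters (w ^ h)).length)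
  rw [h3] at h2 h5
  generalize cyclicLetter (w ^ d) j = c at h1 ⊢
  generalize cyclicLetter (w ^ h) (ZMod.cast j) = c' at h2 ⊢
  generalize j.val = v at h1 h2 h4 h5
  rw [length_letters_pow hw] at h2 h4 h5
  rw [letters_pow hw, getElem?_flatten_replicate _ _ _ h5,
    Nat.mod_mul_left_mod] at h2
  rw [letters_pow hw, getElem?_flatten_replicate _ _ _ h4, h2] at h1
  exact (Option.some.inj h1).symm

lemma isCyclicReduced_cyclicLetter (hw : FreeGroup.IsCyclicallyReduced w.toWord)
    [NeZero (letters w).length] : IsCyclicReduced (cyclicLetter w) := by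
  have hchain : ∀ t, ∀ b ∈ (letters w)[t]?, ∀ c ∈ (letters w)[t + 1]?, c ≠ invLetter b := by
    intro t b hb c hc e
    have h1 : (letters w).IsChain (fun b c => c.1 = b.1 → c.2 = b.2) := by
      rw [letters, List.isChain_reverse]
      exact hw.isReduced
    obtain ⟨ht, hb⟩ := List.getElem?_eq_some_iff.1 hb
    obtain ⟨ht', hc⟩ := List.getElem?_eq_some_iff.1 hc
    have h2 := List.isChain_iff_getElem.1 h1 t ht'
    rw [hb, hc, e] at h2
    have := h2 rfl
    simp [invLetter] at this
  have hends : ∀ b ∈ (letters w).getLast?, ∀ c ∈ (letters w).head?, c ≠ invLetter b := by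
    intro b hb c hc e
    rw [letters, List.getLast?_reverse] at hb
    rw [letters, List.head?_reverse] at hc
    have := hw.2 c hc b hb
    rw [e] at this
    have := this rfl
    simp [invLetter] at this
  intro j
  have hj := ZMod.val_lt j
  rcases (Nat.succ_le_of_lt hj).lt_or_eq with h2 | h2
  · refine hchain j.val _ (cyclicLetter_eq_some j) _ ?_
    rw [Option.mem_def, cyclicLetter_natCast h2]
    push_cast
    rw [ZMod.natCast_zmod_val]
  · have h3 : j + 1 = 0 := by
      have : (((j.val + 1 : ℕ)) : ZMod (letters w).length) = 0 := by
        rw [← Nat.succ_eq_add_one, h2, ZMod.natCast_self]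
      push_cast at this
      rwa [ZMod.natCast_zmod_val] at this
    refine hends _ ?_ _ ?_
    · rw [List.getLast?_eq_getElem?, Option.mem_def, ← cyclicLetter_eq_some,
        show (letters w).length - 1 = j.val by omega]
    · rw [List.head?_eq_getElem?, Option.mem_def, ← cyclicLetter_eq_some, h3, ZMod.val_zero]

/-- The periods of the cyclic word of a power of an element which is not a power. -/
lemma length_dvd_of_period (hw : FreeGroup.IsCyclicallyReduced w.toWord) (hpow : ¬ IsPower w)
    {d : ℕ} [NeZero (letters (w ^ d)).length] {p : ℕ}
    (hp : ∀ j, cyclicLetter (w ^ d) (j + p) = cyclicLetter (w ^ d) j) :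
    (letters w).length ∣ p := by
  set m := (letters w).length with hm
  have hlen : (letters (w ^ d)).length = d * m := length_letters_pow hw d
  have hdm : 0 < d * m := by
    rw [← hlen]
    exact Nat.pos_of_ne_zero (NeZero.ne _)
  have hm0 : 0 < m := Nat.pos_of_mul_pos_left hdm
  have hd0 : 0 < d := Nat.pos_of_mul_pos_right hdm
  have hget : ∀ t, t < d * m → (letters (w ^ d))[t]? = (letters w)[t % m]? := fun t ht => by
    rw [letters_pow hw, getElem?_flatten_replicate _ _ _ ht]
  have hnat : ∀ t : ℕ, (letters w)[t % m]? = some (cyclicLetter (w ^ d) t) := by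
    intro t
    have h1 := cyclicLetter_eq_some (w := w ^ d) t
    rw [ZMod.val_natCast] at h1
    rw [← h1, hlen, hget _ (Nat.mod_lt _ hdm), Nat.mod_mul_left_mod]
  let H : AddSubgroup (ZMod (letters (w ^ d)).length) :=
    { carrier := {t | ∀ j, cyclicLetter (w ^ d) (j + t) = cyclicLetter (w ^ d) j}
      zero_mem' := fun j => by rw [add_zero]
      add_mem' := fun {s t} hs ht j => by rw [← add_assoc, ht, hs]
      neg_mem' := fun {s} hs j => by
        have := hs (j + -s)
        rw [neg_add_cancel_right] at this
        exact this.symm }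
  have hpH : (p : ZMod (letters (w ^ d)).length) ∈ H := hp
  have hmH : (m : ZMod (letters (w ^ d)).length) ∈ H := by
    intro j
    have h1 := hnat (j.val + m)
    rw [Nat.add_mod_right, hnat j.val] at h1
    push_cast at h1
    rw [ZMod.natCast_zmod_val] at h1
    exact (Option.some.inj h1).symm
  set g := Nat.gcd p m with hg
  -- The periods form a group containing `p` and the length `m` of `w`, hence by Bézout their gcd.
  have hgH : (g : ZMod (letters (w ^ d)).length) ∈ H := by
    have h1 := Nat.gcd_eq_gcd_ab p m
    have h2 := congrArg (Int.cast : ℤ → ZMod (letters (w ^ d)).length) h1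
    push_cast at h2
    rw [hg, h2, mul_comm, mul_comm (Nat.cast m), ← zsmul_eq_mul, ← zsmul_eq_mul]
    exact H.add_mem (H.zsmul_mem hpH _) (H.zsmul_mem hmH _)
  obtain ⟨q, hq⟩ : g ∣ m := Nat.gcd_dvd_right p m
  have hg0 : 0 < g := Nat.gcd_pos_of_pos_right _ hm0
  have hmod : ∀ t, t < (letters w).length → (letters w)[t]? = (letters w)[t % g]? := by
    intro t ht
    have h1 : ((g * (t / g) : ℕ) : ZMod (letters (w ^ d)).length) ∈ H := by
      rw [mul_comm, Nat.cast_mul, ← nsmul_eq_mul]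
      exact H.nsmul_mem hgH _
    have h2 := h1 ((t % g : ℕ) : ZMod (letters (w ^ d)).length)
    rw [← Nat.cast_add, Nat.mod_add_div] at h2
    have h3 := hnat t
    have h4 := hnat (t % g)
    rw [Nat.mod_eq_of_lt ht] at h3
    rw [Nat.mod_eq_of_lt ((Nat.mod_le t g).trans_lt ht)] at h4
    rw [h3, h4, h2]
  have hrep := eq_flatten_replicate_take (letters w) q g (by rw [← hm, hq, mul_comm]) hmod
  have hq1 : q = 1 := by
    by_contra hne
    -- With period `g`, the word `w` is a `q`-fold repetition. The root is reversed because
    -- `letters` lists the word from right to left.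
    refine hpow ⟨FreeGroup.mk ((letters w).take g).reverse, q, ?_, ?_⟩
    · have : q ≠ 0 := by
        rintro rfl
        omega
      omega
    · rw [FreeGroup.pow_mk]
      have h1 := congrArg List.reverse hrep
      rw [letters, List.reverse_reverse, List.reverse_flatten] at h1
      conv_lhs => rw [← FreeGroup.mk_toWord (x := w), h1]
      simp [letters]
  rw [hq, hq1, mul_one]
  exact Nat.gcd_dvd_left p m

end Periods

/-! ### The graphs of a cycle -/

section Syllables

variable {α : Type*} {L : List (α × ℤ)}

/-- The number of letters before the `t`-th syllable. -/
def offset (L : List (α × ℤ)) (t : ℕ) : ℕ := (spell (L.take t)).length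

lemma spell_cons (p : α × ℤ) (L : List (α × ℤ)) : spell (p :: L) = spellSyllable p ++ spell L :=
  rfl

lemma spell_append (L L' : List (α × ℤ)) : spell (L ++ L') = spell L ++ spell L' := by
  simp [spell]

lemma length_spellSyllable (p : α × ℤ) : (spellSyllable p).length = p.2.natAbs := by
  simp [spellSyllable]

lemma offset_succ {t : ℕ} (ht : t < L.length) :
    offset L (t + 1) = offset L t + L[t].2.natAbs := by
  rw [offset, offset, ← List.take_append_getElem ht, spell_append, List.length_append, spell_cons,
    List.length_append, length_spellSyllable]
  rfl

lemma offset_length : offset L L.length = (spell L).length := by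
  rw [offset, List.take_length]

lemma offset_mono : Monotone (offset L) := by
  refine monotone_nat_of_le_succ fun t => ?_
  rcases lt_or_ge t L.length with ht | ht
  · rw [offset_succ ht]
    omega
  · rw [offset, offset, List.take_of_length_le ht, List.take_of_length_le (by omega)]

lemma getElem?_spell {t c : ℕ} (ht : t < L.length) (hc : c < L[t].2.natAbs) :
    (spell L)[offset L t + c]? = some (L[t].1, decide (0 < L[t].2)) := by
  have h1 : spell L = spell (L.take t) ++ (spellSyllable L[t] ++ spell (L.drop (t + 1))) := by
    rw [← spell_cons, ← spell_append, List.getElem_cons_drop, List.take_append_drop]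
  rw [h1, offset, List.getElem?_append_right (by omega), Nat.add_sub_cancel_left,
    List.getElem?_append_left (by rwa [length_spellSyllable]), spellSyllable,
    List.getElem?_replicate_of_lt hc]

lemma offset_add_lt {t c : ℕ} (ht : t < L.length) (hc : c < L[t].2.natAbs) :
    offset L t + c < (spell L).length :=
  (List.getElem?_eq_some_iff.1 (getElem?_spell ht hc)).1

lemma exists_offset {s : ℕ} (hs : s < (spell L).length) :
    ∃ (t : ℕ) (ht : t < L.length) (c : ℕ), c < L[t].2.natAbs ∧ s = offset L t + c := by
  induction L generalizing s with
  | nil => simp [spell] at hs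
  | cons p L ih =>
    rcases lt_or_ge s p.2.natAbs with h | h
    · exact ⟨0, by simp, s, h, by simp [offset, spell]⟩
    · rw [spell_cons, List.length_append, length_spellSyllable] at hs
      obtain ⟨t, ht, c, hc, e⟩ := ih (s := s - p.2.natAbs) (by omega)
      refine ⟨t + 1, by simpa using ht, c, hc, ?_⟩
      have h1 : offset (p :: L) (t + 1) = p.2.natAbs + offset L t := by
        rw [offset, List.take_succ_cons, spell_cons, List.length_append, length_spellSyllable,
          offset]
      omega

lemma offset_add_inj {t t' c c' : ℕ} (ht : t < L.length) (ht' : t' < L.length)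
    (hc : c < L[t].2.natAbs) (hc' : c' < L[t'].2.natAbs)
    (h : offset L t + c = offset L t' + c') : t = t' ∧ c = c' := by
  have key : t = t' := by
    rcases lt_trichotomy t t' with hlt | rfl | hlt
    · have h1 := offset_mono (L := L) (Nat.succ_le_of_lt hlt)
      rw [Nat.succ_eq_add_one, offset_succ ht] at h1
      omega
    · rfl
    · have h1 := offset_mono (L := L) (Nat.succ_le_of_lt hlt)
      rw [Nat.succ_eq_add_one, offset_succ ht'] at h1
      omega
  subst key
  exact ⟨rfl, by omega⟩

/-- The entries kept by a filter, as indices in the original list. -/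
lemma exists_filter_index {β : Type*} (l : List β) (P : β → Bool) :
    ∃ f : Fin (l.filter P).length → Fin l.length, Function.Injective f ∧
      (∀ j, (l.filter P).get j = l.get (f j)) ∧ ∀ t, P (l.get t) → ∃ j, f j = t := by
  set F := (List.finRange l.length).filter fun t => P (l.get t) with hF
  have h1 : l.filter P = F.map l.get := by
    conv_lhs => rw [← List.map_get_finRange l, List.filter_map]
    rfl
  have h2 : (l.filter P).length = F.length := by rw [h1, List.length_map]
  refine ⟨fun j => F.get (j.cast h2), ?_, ?_, ?_⟩
  · intro j j' h
    have hnd : F.Nodup := (List.nodup_finRange _).filter _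
    have := hnd.injective_get h
    exact Fin.cast_injective _ this
  · intro j
    simp [h1]
  · intro t ht
    have hmem : t ∈ F := by simpa [hF] using ht
    obtain ⟨j, hj⟩ := List.mem_iff_get.1 hmem
    exact ⟨j.cast h2.symm, by simpa using hj⟩

end Syllables

/-! ### Syllables as paths in a labelled cycle -/

section CycleGraph

variable {k p : ℕ} {L : List (Fin k × ℤ)} {b : ZMod p → Fin k × Bool}

/-- Words act from the right, so the written letter at position `s` is read at step `-(s + 1)`,
between the vertices `-(s + 1)` and `-s`. This is the indexing in `hb`. -/
lemma letter_of_syllable (hp : p = (spell L).length)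
    (hb : ∀ s < p, (spell L)[s]? = some (b (-((s : ZMod p) + 1)))) {t c : ℕ}
    (ht : t < L.length) (hc : c < L[t].2.natAbs) :
    b (-(((offset L t + c : ℕ) : ZMod p) + 1)) = (L[t].1, decide (0 < L[t].2)) := by
  have h1 := hb _ (hp ▸ offset_add_lt ht hc)
  rw [getElem?_spell ht hc] at h1
  exact (Option.some.inj h1).symm

lemma colour_after_syllable (hp : p = (spell L).length)
    (hb : ∀ s < p, (spell L)[s]? = some (b (-((s : ZMod p) + 1))))
    (h0 : ∀ q ∈ L, q.2 ≠ 0) (hL : L.IsChain (fun q q' => q.1 ≠ q'.1))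
    (hends : ∀ q ∈ L.head?, ∀ q' ∈ L.getLast?, q'.1 ≠ q.1) {t : ℕ} (ht : t < L.length) :
    (b (-(((offset L t + L[t].2.natAbs : ℕ) : ZMod p) + 1))).1 ≠ L[t].1 := by
  rw [← offset_succ ht]
  have hpos : ∀ u (hu : u < L.length), 0 < L[u].2.natAbs := fun u hu =>
    Int.natAbs_pos.2 (h0 _ (List.getElem_mem hu))
  rcases (Nat.succ_le_of_lt ht).lt_or_eq with h | h
  · have h1 := letter_of_syllable hp hb h (hpos _ h)
    rw [add_zero] at h1
    rw [← Nat.succ_eq_add_one, h1]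
    exact (List.isChain_iff_getElem.1 hL t h).symm
  -- After the last syllable the position `p` wraps around to the first one; `hends` separates the
  -- two colours.
  · have hl : 0 < L.length := by omega
    have h1 := letter_of_syllable hp hb hl (hpos _ hl)
    have h2 : offset L (t + 1) = p := by
      rw [← Nat.succ_eq_add_one, h, offset_length, hp]
    have h3 : offset L 0 = 0 := by simp [offset, spell]
    rw [h2, ZMod.natCast_self, ← Nat.cast_zero, show 0 = offset L 0 + 0 by rw [h3], h1]
    refine (hends L[0] ?_ L[t] ?_).symm
    · rw [List.head?_eq_getElem?, Option.mem_def, List.getElem?_eq_getElem hl]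
    · rw [List.getLast?_eq_getElem?, Option.mem_def, show L.length - 1 = t by omega,
        List.getElem?_eq_getElem ht]

/-- Paths of one colour are disjoint, endpoints included. The letter written at a position inside a
syllable has its colour, while the one just after its end has another, so an end cannot meet an
inner position of a syllable of the same colour. -/
lemma syllable_vertex_inj (hp : p = (spell L).length)
    (hb : ∀ s < p, (spell L)[s]? = some (b (-((s : ZMod p) + 1))))
    (h0 : ∀ q ∈ L, q.2 ≠ 0) (hL : L.IsChain (fun q q' => q.1 ≠ q'.1))
    (hends : ∀ q ∈ L.head?, ∀ q' ∈ L.getLast?, q'.1 ≠ q.1) {t t' c c' : ℕ}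
    (ht : t < L.length) (ht' : t' < L.length) (htt : L[t].1 = L[t'].1)
    (hc : c ≤ L[t].2.natAbs) (hc' : c' ≤ L[t'].2.natAbs)
    (h : ((offset L t + c : ℕ) : ZMod p) = ((offset L t' + c' : ℕ) : ZMod p)) :
    t = t' ∧ c = c' := by
  have hpos : ∀ u (hu : u < L.length), 0 < L[u].2.natAbs := fun u hu =>
    Int.natAbs_pos.2 (h0 _ (List.getElem_mem hu))
  have inner : ∀ {c c' : ℕ}, c < L[t].2.natAbs → c' < L[t'].2.natAbs →
      ((offset L t + c : ℕ) : ZMod p) = ((offset L t' + c' : ℕ) : ZMod p) → t = t' ∧ c = c' := by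
    intro c c' hc hc' h
    rw [ZMod.natCast_eq_natCast_iff'] at h
    rw [Nat.mod_eq_of_lt (hp ▸ offset_add_lt ht hc), Nat.mod_eq_of_lt (hp ▸ offset_add_lt ht' hc')]
      at h
    exact offset_add_inj ht ht' hc hc' h
  rcases hc.lt_or_eq with h1 | h1 <;> rcases hc'.lt_or_eq with h2 | h2
  · exact inner h1 h2 h
  · exfalso
    have h3 := colour_after_syllable hp hb h0 hL hends ht'
    rw [← h2, ← h, letter_of_syllable hp hb ht h1] at h3
    exact h3 htt
  · exfalso
    have h3 := colour_after_syllable hp hb h0 hL hends ht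
    rw [← h1, h, letter_of_syllable hp hb ht' h2] at h3
    exact h3 htt.symm
  -- Two ends are compared after moving both back by one letter.
  · have h3 := hpos t ht
    have h4 := hpos t' ht'
    have h5 := inner (c := c - 1) (c' := c' - 1) (by omega) (by omega) (by
      rw [← Nat.add_sub_assoc (by omega), ← Nat.add_sub_assoc (by omega),
        Nat.cast_sub (by omega), Nat.cast_sub (by omega), h])
    omega

/-- The edges of a given colour of a cycle form straight paths, one for each syllable. -/
lemma pathForest_equiv_walkGraph [NeZero p] (hp : p = (spell L).length)
    (hb : ∀ s < p, (spell L)[s]? = some (b (-((s : ZMod p) + 1))))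
    (h0 : ∀ q ∈ L, q.2 ≠ 0) (hL : L.IsChain (fun q q' => q.1 ≠ q'.1))
    (hends : ∀ q ∈ L.head?, ∀ q' ∈ L.getLast?, q'.1 ≠ q.1) (i : Fin k) :
    GraphEquiv (pathForest (gammaTuple i L)) (walkGraph b id i) := by
  obtain ⟨f, hf, hget, hsurj⟩ := exists_filter_index L (fun q => decide (q.1 = i))
  have hlen : (gammaTuple i L).length = (L.filter fun q => decide (q.1 = i)).length := by
    rw [gammaTuple, List.length_map]
  let e : Fin (gammaTuple i L).length → Fin L.length := fun j => f (j.cast hlen)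
  have he : Function.Injective e := hf.comp (Fin.cast_injective hlen)
  have hγ : ∀ j, (gammaTuple i L).get j = L[(e j : ℕ)].2.natAbs := by
    intro j
    have h1 : (gammaTuple i L).get j
        = ((L.filter fun q => decide (q.1 = i)).get (j.cast hlen)).2.natAbs := List.getElem_map _
    rw [h1, hget]
    rfl
  have hcol : ∀ j, L[(e j : ℕ)].1 = i := by
    intro j
    have h1 : (L.filter fun q => decide (q.1 = i)).get (j.cast hlen) ∈
      (L.filter fun q => decide (q.1 = i)) := List.get_mem _ _
    rw [hget] at h1
    simpa using (List.mem_filter.1 h1).2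
  have hesurj : ∀ t (ht : t < L.length), L[t].1 = i → ∃ j, (e j : ℕ) = t := by
    intro t ht hti
    obtain ⟨j, hj⟩ := hsurj ⟨t, ht⟩ (by simpa using hti)
    refine ⟨j.cast hlen.symm, ?_⟩
    have : e (j.cast hlen.symm) = f j := rfl
    rw [this, hj]
  -- The walk traverses written positions in decreasing order. A positive syllable is oriented along
  -- the walk, so its path runs against the positions; a negative one runs with them.
  let pos : Fin (gammaTuple i L).length → ℕ → ℕ := fun j c =>
    if 0 < L[(e j : ℕ)].2 then L[(e j : ℕ)].2.natAbs - c else c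
  have hpos_le : ∀ j c, c ≤ L[(e j : ℕ)].2.natAbs → pos j c ≤ L[(e j : ℕ)].2.natAbs := by
    intro j c hc
    dsimp only [pos]
    split_ifs <;> omega
  let φ : (Σ j : Fin (gammaTuple i L).length, Fin ((gammaTuple i L).get j + 1)) → ZMod p :=
    fun q => -((offset L (e q.1) + pos q.1 q.2 : ℕ) : ZMod p)
  have hle : ∀ q : (Σ j : Fin (gammaTuple i L).length, Fin ((gammaTuple i L).get j + 1)),
      (q.2 : ℕ) ≤ L[(e q.1 : ℕ)].2.natAbs := by
    intro q
    rw [← hγ]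
    exact Nat.lt_succ_iff.1 q.2.2
  refine GraphEquiv.of_injective φ ?_ ?_
  · rintro q q' h
    have h1 := syllable_vertex_inj hp hb h0 hL hends (e q.1).2 (e q'.1).2
      ((hcol _).trans (hcol _).symm) (hpos_le _ _ (hle q)) (hpos_le _ _ (hle q')) (neg_injective h)
    have hq := hle q
    have hq' := hle q'
    obtain ⟨j, c⟩ := q
    obtain ⟨j', c'⟩ := q'
    obtain rfl : j = j' := he (Fin.ext h1.1)
    have h2 := h1.2
    dsimp only [pos] at h2 hq hq'
    obtain rfl : c = c' := Fin.ext (by split_ifs at h2 <;> omega)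
    rfl
  -- The letter crossing the `c`-th edge of a path is the written letter between the positions of
  -- its two endpoints, whence the shift by one for positive exponents.
  · have edge : ∀ (j : Fin (gammaTuple i L).length) (c : ℕ) (hc : c < L[(e j : ℕ)].2.natAbs)
        (u : ZMod p), u = -(((offset L (e j) +
          (if 0 < L[(e j : ℕ)].2 then L[(e j : ℕ)].2.natAbs - c - 1 else c) : ℕ) : ZMod p) + 1) →
        (b u).1 = i ∧
        stepSource b id u = -((offset L (e j) + pos j c : ℕ) : ZMod p) ∧
        stepTarget b id u = -((offset L (e j) + pos j (c + 1) : ℕ) : ZMod p) := by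
      rintro j c hc u rfl
      have h1 := letter_of_syllable hp hb (e j).2 (c := if 0 < L[(e j : ℕ)].2 then
        L[(e j : ℕ)].2.natAbs - c - 1 else c) (by split_ifs <;> omega)
      refine ⟨by rw [h1]; exact hcol j, ?_⟩
      unfold stepSource stepTarget
      rw [h1]
      dsimp only [pos, id]
      by_cases hβ : 0 < L[(e j : ℕ)].2
      · simp only [hβ, decide_true, if_true]
        have h2 : offset L (e j) + (L[(e j : ℕ)].2.natAbs - c)
          = offset L (e j) + (L[(e j : ℕ)].2.natAbs - c - 1) + 1 := by omega
        rw [h2, Nat.sub_sub]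
        push_cast
        constructor <;> ring
      · simp only [hβ, decide_false, if_false, Bool.false_eq_true]
        push_cast
        constructor <;> ring
    intro u v
    constructor
    · rintro ⟨s, hs, rfl, rfl⟩
      obtain ⟨s, hsp, rfl⟩ : ∃ s' < p, s = -((s' : ZMod p) + 1) := by
        refine ⟨(-s - 1).val, ZMod.val_lt _, ?_⟩
        rw [ZMod.natCast_zmod_val]
        ring
      obtain ⟨t, ht, c, hc, rfl⟩ := exists_offset (hp ▸ hsp)
      rw [letter_of_syllable hp hb ht hc] at hs
      obtain ⟨j, rfl⟩ := hesurj t ht hs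
      -- The passage from letter positions to edge numbers is an involution, so the formula used in
      -- `edge` also inverts it.
      set c' := if 0 < L[(e j : ℕ)].2 then L[(e j : ℕ)].2.natAbs - c - 1 else c with hc'def
      have hc' : c' < L[(e j : ℕ)].2.natAbs := by
        rw [hc'def]
        split_ifs <;> omega
      have hcc : (if 0 < L[(e j : ℕ)].2 then L[(e j : ℕ)].2.natAbs - c' - 1 else c') = c := by
        rw [hc'def]
        split_ifs <;> omega
      obtain ⟨-, h2, h3⟩ := edge j c' hc' _ rfl
      rw [hcc] at h2 h3
      have hlt : c' < (gammaTuple i L).get j := by rwa [hγ]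
      exact ⟨⟨j, (⟨c', hlt⟩ : Fin _).castSucc⟩, ⟨j, (⟨c', hlt⟩ : Fin _).succ⟩, h2.symm, h3.symm,
        j, ⟨c', hlt⟩, rfl, rfl⟩
    · rintro ⟨_, _, rfl, rfl, j, c, rfl, rfl⟩
      have hc : (c : ℕ) < L[(e j : ℕ)].2.natAbs := by
        rw [← hγ]
        exact c.2
      obtain ⟨h1, h2, h3⟩ := edge j c hc _ rfl
      exact ⟨_, h1, h2.symm, h3.symm⟩

end CycleGraph

/-! ### Powers of reduced forms -/

section PowerForm

variable {k : ℕ} {w : FreeGroup (Fin k)} {L : List (Fin k × ℤ)}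

lemma IsReducedForm.toWord_eq (hL : IsReducedForm L w) : w.toWord = spell L := by
  rw [hL.2.2, ← mk_spell, FreeGroup.toWord_mk, (isReduced_spell hL.1 hL.2.1).reduce_eq]

lemma spell_flatten_replicate (d : ℕ) :
    spell (List.replicate d L).flatten = (List.replicate d (spell L)).flatten := by
  induction d with
  | zero => rfl
  | succ d ih =>
    rw [List.replicate_succ, List.replicate_succ, List.flatten_cons, List.flatten_cons,
      spell_append, ih]

lemma IsReducedForm.pow (hL : IsReducedForm L w)
    (hends : ∀ p ∈ L.head?, ∀ q ∈ L.getLast?, q.1 ≠ p.1) (d : ℕ) :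
    IsReducedForm (List.replicate d L).flatten (w ^ d) := by
  refine ⟨?_, isChain_flatten_replicate hL.2.1 (fun p hp q hq => hends q hq p hp) d, ?_⟩
  · intro p hp
    obtain ⟨l, hl, hpl⟩ := List.mem_flatten.1 hp
    rw [List.eq_of_mem_replicate hl] at hpl
    exact hL.1 p hpl
  · rw [← mk_spell, spell_flatten_replicate, ← FreeGroup.pow_mk, mk_spell, ← hL.2.2]

lemma gammaTuple_flatten_replicate (i : Fin k) (d : ℕ) :
    gammaTuple i (List.replicate d L).flatten = repeatTuple d (gammaTuple i L) := by
  simp [gammaTuple, repeatTuple, List.filter_flatten, List.map_flatten]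

lemma ends_flatten_replicate (hends : ∀ p ∈ L.head?, ∀ q ∈ L.getLast?, q.1 ≠ p.1) (d : ℕ) :
    ∀ p ∈ ((List.replicate d L).flatten).head?, ∀ q ∈ ((List.replicate d L).flatten).getLast?,
      q.1 ≠ p.1 := by
  rcases eq_or_ne d 0 with rfl | hd
  · simp
  · rwa [List.head?_flatten_replicate hd, List.getLast?_flatten_replicate hd]

lemma IsReducedForm.isCyclicallyReduced (hL : IsReducedForm L w)
    (hends : ∀ p ∈ L.head?, ∀ q ∈ L.getLast?, q.1 ≠ p.1) :
    FreeGroup.IsCyclicallyReduced w.toWord := by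
  refine ⟨FreeGroup.isReduced_toWord, ?_⟩
  rw [hL.toWord_eq]
  intro a ha b hb hab
  exfalso
  rcases eq_or_ne L [] with rfl | hne
  · simp [spell] at ha
  · have h1 : a.1 = (L.getLast hne).1 := by
      conv at ha => rw [← List.dropLast_append_getLast hne, spell_append]
      have h2 : spellSyllable (L.getLast hne) ≠ [] :=
        spellSyllable_ne_nil (hL.1 _ (List.getLast_mem hne))
      have h3 : spell [L.getLast hne] = spellSyllable (L.getLast hne) := by simp [spell]
      rw [h3, List.getLast?_append_of_ne_nil _ h2] at ha
      exact fst_of_mem_spellSyllable (List.mem_of_mem_getLast? ha)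
    have h1' : b.1 = (L.head hne).1 := by
      conv at hb => rw [← List.cons_head_tail hne, spell_cons]
      have h2 : spellSyllable (L.head hne) ≠ [] :=
        spellSyllable_ne_nil (hL.1 _ (List.head_mem hne))
      rw [List.head?_append_of_ne_nil _ h2] at hb
      exact fst_of_mem_spellSyllable (List.mem_of_mem_head? hb)
    exact hends _ (List.head?_eq_some_head hne) _ (List.getLast?_eq_some_getLast hne)
      (by rw [← h1, ← h1', hab])

lemma IsReducedForm.pathForest_equiv (hL : IsReducedForm L w)
    (hends : ∀ p ∈ L.head?, ∀ q ∈ L.getLast?, q.1 ≠ p.1) [NeZero (letters w).length]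
    (i : Fin k) :
    GraphEquiv (pathForest (gammaTuple i L)) (walkGraph (cyclicLetter w) id i) := by
  have hlen : (letters w).length = (spell L).length := by
    rw [letters, List.length_reverse, hL.toWord_eq]
  refine pathForest_equiv_walkGraph hlen ?_ hL.1 hL.2.1 hends i
  intro s hs
  have h1 : (-((s : ZMod (letters w).length) + 1)) = (((letters w).length - (s + 1) : ℕ) :
      ZMod (letters w).length) := by
    rw [Nat.cast_sub hs, ZMod.natCast_self]
    push_cast
    ring
  rw [h1, ← cyclicLetter_natCast (by omega), ← hL.toWord_eq]
  have h2 : (letters w).length = w.toWord.length := by rw [letters, List.length_reverse]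
  rw [h2] at hs ⊢
  rw [letters, List.getElem?_reverse (by omega)]
  congr 1
  omega

end PowerForm

/-! ### The tight patterns of a power -/

section PowerPatterns

variable {k : ℕ} {Ω : FreeGroup (Fin k)} {L : List (Fin k × ℤ)}

/-- The coincidences of a closed walk reading `Ω ^ d` along a cycle labelled by `Ω ^ h`. -/
def windingSetoid (Ω : FreeGroup (Fin k)) (d h : ℕ) : Setoid (ZMod (letters (Ω ^ d)).length) :=
  Setoid.ker (ZMod.cast : ZMod (letters (Ω ^ d)).length → ZMod (letters (Ω ^ h)).length)

lemma length_letters_pow_dvd (hw : FreeGroup.IsCyclicallyReduced Ω.toWord) {d h : ℕ}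
    (hd : h ∣ d) : (letters (Ω ^ h)).length ∣ (letters (Ω ^ d)).length := by
  rw [length_letters_pow hw, length_letters_pow hw]
  exact Nat.mul_dvd_mul_right hd _

lemma length_letters_pos (hΩ : ¬ IsPower Ω) : 0 < (letters Ω).length := by
  rw [letters, List.length_reverse, List.length_pos_iff, Ne, FreeGroup.toWord_eq_nil_iff]
  rintro rfl
  -- The identity is itself a square.
  exact hΩ ⟨1, 2, le_rfl, by simp⟩

/-- The number of classes, `h` times the length of `Ω`, recovers `h`. -/
lemma windingSetoid_injOn (hw : FreeGroup.IsCyclicallyReduced Ω.toWord) (hΩ : ¬ IsPower Ω)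
    {d h h' : ℕ} (hd : h ∣ d) (hd' : h' ∣ d) (e : windingSetoid Ω d h = windingSetoid Ω d h') :
    h = h' := by
  have hcard : ∀ {h}, h ∣ d → Nat.card (Quotient (windingSetoid Ω d h)) = h * (letters Ω).length := by
    intro h hd
    rw [← length_letters_pow hw, ← Nat.card_zmod (letters (Ω ^ h)).length]
    exact Nat.card_congr (Setoid.quotientKerEquivOfSurjective _
      (zmodCast_surjective (length_letters_pow_dvd hw hd)))
  have h1 := hcard hd
  rw [e, hcard hd'] at h1
  exact (Nat.eq_of_mul_eq_mul_right (length_letters_pos hΩ) h1).symm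

/-- A tight pattern comes from a period that divides `d` times the length of `Ω` and is a multiple
of that length, hence from a divisor `h` of `d`. Conversely, winding around the shorter cycle is
tight. -/
lemma isTight_iff_exists_winding (hw : FreeGroup.IsCyclicallyReduced Ω.toWord)
    (hΩ : ¬ IsPower Ω) {d : ℕ} [NeZero (letters (Ω ^ d)).length]
    (K : Setoid (ZMod (letters (Ω ^ d)).length)) :
    IsTight (cyclicLetter (Ω ^ d)) K ↔ ∃ h, h ∣ d ∧ windingSetoid Ω d h = K := by
  have hm := length_letters_pos hΩ
  have hr : 0 < (letters (Ω ^ d)).length := Nat.pos_of_ne_zero (NeZero.ne _)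
  constructor
  · intro hK
    obtain ⟨p, hpr, hper, rfl⟩ :=
      hK.exists_period (isCyclicReduced_cyclicLetter (isCyclicallyReduced_pow hw d))
    obtain ⟨h, rfl⟩ := length_dvd_of_period hw hΩ hper
    refine ⟨h, ?_, ?_⟩
    · rw [length_letters_pow hw, mul_comm] at hpr
      exact Nat.dvd_of_mul_dvd_mul_right hm hpr
    · rw [windingSetoid, length_letters_pow hw h, mul_comm]
  · rintro ⟨h, hd, rfl⟩
    have : NeZero (letters (Ω ^ h)).length :=
      ⟨(Nat.pos_of_dvd_of_pos (length_letters_pow_dvd hw hd) hr).ne'⟩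
    exact isTight_ker_cast (length_letters_pow_dvd hw hd) (fun j => cyclicLetter_pow_cast hw j)
      (isCyclicReduced_cyclicLetter (isCyclicallyReduced_pow hw h))

/-- The graph class of a walk winding along the cycle labelled by `Ω ^ h`. -/
lemma graphClass_winding (hL : IsReducedForm L Ω)
    (hends : ∀ p ∈ L.head?, ∀ q ∈ L.getLast?, q.1 ≠ p.1) {d h n : ℕ} (hd : h ∣ d)
    [NeZero (letters (Ω ^ d)).length] {x : ZMod (letters (Ω ^ d)).length → Fin n}
    (hx : Setoid.ker x = windingSetoid Ω d h) (i : Fin k) :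
    graphClass (walkGraph (cyclicLetter (Ω ^ d)) x i)
      = straightClass (repeatTuple h (gammaTuple i L)) := by
  have hw := hL.isCyclicallyReduced hends
  have hr : 0 < (letters (Ω ^ d)).length := Nat.pos_of_ne_zero (NeZero.ne _)
  have hdvd := length_letters_pow_dvd hw hd
  have : NeZero (letters (Ω ^ h)).length := ⟨(Nat.pos_of_dvd_of_pos hdvd hr).ne'⟩
  have h1 := (hL.pow hends h).pathForest_equiv (ends_flatten_replicate hends h) i
  rw [gammaTuple_flatten_replicate] at h1
  refine GraphEquiv.straightClass_eq (h1.trans ?_)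
  rw [← walkGraph_cast hdvd (fun j => cyclicLetter_pow_cast hw j)]
  refine walkGraph_equiv (fun j j' => ?_) i
  rw [← Setoid.ker_def, ← Setoid.ker_def, hx, windingSetoid]

end PowerPatterns

end WordPerm

/-- The ground set `Fin (n + 1)` runs through all positive sizes, and `0` plays the role of the
point `1`. -/
theorem proposition3 {k : ℕ} (Ω : FreeGroup (Fin k)) (hΩ : ¬ IsPower Ω)
    (L : List (Fin k × ℤ)) (hL : IsReducedForm L Ω)
    (hends : ∀ p ∈ L.head?, ∀ q ∈ L.getLast?, q.1 ≠ p.1)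
    (d : ℕ) (hd : 1 ≤ d)
    {S : ℕ → Type*} [∀ n, MeasurableSpace (S n)] (μ : ∀ n, Measure (S n))
    [∀ n, IsProbabilityMeasure (μ n)]
    (ρ : ∀ n, Fin k → S n → Equiv.Perm (Fin (n + 1)))
    (hmeas : ∀ n i, Measurable (ρ n i))
    (hunif : ∀ n i, (μ n).map (ρ n i) = uniformOn Set.univ)
    (hindep : ∀ n, iIndepFun (ρ n) (μ n))
    (g : Fin k → GraphClass) :
    Tendsto
      (fun n : ℕ => ((n + 1 : ℕ) : ℝ) *
        (μ n).real {s | (∀ i, graphClass (trajGraph (Ω ^ d) (fun a => ρ n a s) 0 i) = g i) ∧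
          cycleLength (wordMap (Ω ^ d) (fun a => ρ n a s)) 0 = 1})
      atTop
      (𝓝 (∑ h ∈ d.divisors, ∏ i : Fin k,
        if g i = straightClass (repeatTuple h (gammaTuple i L)) then (1 : ℝ) else 0)) := by
  classical
  have hw := hL.isCyclicallyReduced hends
  have hr : NeZero (letters (Ω ^ d)).length := ⟨by
    rw [length_letters_pow hw]
    exact (Nat.mul_pos hd (length_letters_pos hΩ)).ne'⟩
  have := Fintype.ofFinite (Setoid (ZMod (letters (Ω ^ d)).length))
  -- A model walk with each given kernel, on a vertex set of the form `Fin m`, turns the condition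
  -- on the graph classes into a predicate on patterns.
  let rep : ∀ K : Setoid (ZMod (letters (Ω ^ d)).length),
      ZMod (letters (Ω ^ d)).length → Fin (Fintype.card (Quotient K)) :=
    fun K j => Fintype.equivFin (Quotient K) (Quotient.mk K j)
  have hrep : ∀ K, Setoid.ker (rep K) = K := by
    intro K
    ext j j'
    rw [Setoid.ker_def, (Fintype.equivFin (Quotient K)).injective.eq_iff]
    exact Quotient.eq
  let P : Setoid (ZMod (letters (Ω ^ d)).length) → Prop := fun K =>
    ∀ i, graphClass (walkGraph (cyclicLetter (Ω ^ d)) (rep K) i) = g i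
  have hP : ∀ {n : ℕ} (x : ZMod (letters (Ω ^ d)).length → Fin n),
      (∀ i, graphClass (walkGraph (cyclicLetter (Ω ^ d)) x i) = g i) ↔ P (Setoid.ker x) := by
    intro n x
    refine forall_congr' fun i => ?_
    have h1 : graphClass (walkGraph (cyclicLetter (Ω ^ d)) x i)
        = graphClass (walkGraph (cyclicLetter (Ω ^ d)) (rep (Setoid.ker x)) i) := by
      rw [graphClass_eq_iff]
      refine walkGraph_equiv (fun j j' => ?_) i
      rw [← Setoid.ker_def, ← Setoid.ker_def, hrep]
    rw [h1]
  have hlim := tendsto_succ_mul_real_exists_walk (cyclicLetter (Ω ^ d))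
    (isCyclicReduced_cyclicLetter (isCyclicallyReduced_pow hw d)) P hmeas hunif hindep
  simp_rw [trajectory_event_iff, hP]
  convert hlim using 2
  have htight : (Finset.univ.filter fun K => IsTight (cyclicLetter (Ω ^ d)) K)
      = d.divisors.image (windingSetoid Ω d) := by
    ext K
    rw [Finset.mem_filter, Finset.mem_image, isTight_iff_exists_winding hw hΩ]
    simp [Nat.ne_of_gt hd]
  simp_rw [and_comm (a := P _), ite_and]
  rw [← Finset.sum_filter, htight, Finset.sum_image]
  · refine Finset.sum_congr rfl fun h hh => ?_
    have hiff : P (windingSetoid Ω d h) ↔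
        -- Written over `Finset.univ` so that the product of indicators collapses to a single
        -- indicator.
        ∀ i ∈ Finset.univ, g i = straightClass (repeatTuple h (gammaTuple i L)) := by
      simp only [Finset.mem_univ, true_implies]
      refine forall_congr' fun i => ?_
      rw [graphClass_winding hL hends (Nat.dvd_of_mem_divisors hh) (hrep _) i]
      exact eq_comm
    rw [Finset.prod_ite_zero, Finset.prod_const_one]
    split_ifs <;> tauto
  · intro h hh h' hh' e
    exact windingSetoid_injOn hw hΩ (Nat.dvd_of_mem_divisors hh) (Nat.dvd_of_mem_divisors hh') e
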